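/- Let $G=(V,E)$ be a finite simple undirected graph with at least one edge, $d(x)$ the degree of $x$, $\mu(S)=\sum_{x\in S}d(x)$, $\partial(S)$ the number of edges between $S$ and $V\setminus S$, and $\phi(S)=\partial(S)/\mu(S)$. Let $p(x,y)$ be the lazy random walk kernel ($p(x,x)=1/2$, $p(x,y)=1/(2d(x))$ for $y\sim x$), and $p(y,S)=\sum_{z\in S}p(y,z)$. For an integer $T\ge 0$ let $\theta_T=\sqrt{4T^{-1}\log\mu(V)}$ (with $\theta_0=\infty$). The procedure $\mathtt{GenerateSample}(x,T,B)$ starts with $X_0=x$, $S_0=\{x\}$ and, in step $t$, moves $X_{t-1}$ to $X_t$ by the kernel $p$, picks $Z$ uniformly in $[0,p(X_t,S_{t-1})]$ and sets $S_t=\{y: p(y,S_{t-1})\ge Z\}$; it outputs $S_\tau$, where $\tau$ is the first time $t\geq 0$ at which $\phi(S_t)<\theta_T$, or $t=T$, or $\mathrm{cost}(S_0,\dots,S_t)>B$, with $\mathrm{cost}(S_0,\dots,S_t)=\mu(S_0)+\sum_{j=1}^t(\mu(S_j\Delta S_{j-1})+\partial(S_{j-1}))$. It stores the vertices of $S_t$,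 and the vertices $y$ of the two-sided vertex boundary of $S_t$ with the numbers $e(y,S_t)$ of neighbours of $y$ in $S_t$, in two balanced search trees, and finds $S_t\Delta S_{t-1}$ by iterating over the boundary of $S_{t-1}$; if the budget $B$ is exceeded it halts before updating the trees. For $\phi\in(0,1)$ the algorithm $\mathtt{EvoNibble}(\phi)$ sets $T=\lfloor\phi^{-1}/100\rfloor$, chooses $X\in V$ with $P(X=x)=d(x)/\mu(V)$, chooses independently an integer $J\in[0,\lceil\log_2\mu(V)\rceil]$ with $P(J=j)$ proportional to $2^{-j}$, computes $S=\mathtt{GenerateSample}(X,T,B_J)$ with $B_j=8\gamma 2^j$, $\gamma=1+4\sqrt{T\log\mu(V)}$, and outputs $S$ if $\phi(S)\le 3\theta_T$ and $\mu(S)\le\frac34\mu(V)$, and $\emptyset$ otherwise. The complexity is the number of steps, where real arithmetic, a degree query, a uniform random neighbour, a uniform random real and the choice of $X$ take constant time, listing the neighbours of $y$ takes time $d(y)+1$, a search tree operation takes time proportional to the depth of the tree plus one, choosing $J$ takes time $\lceil\log_2\mu(V)\rceil+1$, and the final test on $S$ counts as a constant number of steps. There is an absolute constant $C>0$ such that for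 every such $G$ and every $\phi\in(0,1)$: 1. the expected complexity of $\mathtt{EvoNibble}(\phi)$ is at most $C\,\phi^{-1/2}\log^{5/2}\mu(V)$; 2. every output $S$ that has positive probability satisfies either $S=\emptyset$, or both $\phi(S)\le C\sqrt{\phi\log\mu(V)}$ and $\mu(S)\le\frac34\mu(V)$; 3. for every $A\subseteq V$ with $0<\mu(A)\le\frac23\mu(V)$ and $\phi(A)\le\phi$, the output $S$ satisfies $\mathbf E\left[\mu(S\cap A)/\mu(A)\right]\ge\frac{1}{20\,\mu(V)}$. -/

import Mathlib

open scoped ENNReal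

/-! ## Graph quantities -/

namespace SimpleGraph

variable {V : Type*} [Fintype V] [DecidableEq V] (G : SimpleGraph V) [DecidableRel G.Adj]

/-- The volume of a set of vertices: the sum of the degrees. -/
def volume (S : Finset V) : ℕ := ∑ x ∈ S, G.degree x

/-- The number of edges between `S` and its complement. -/
def boundary (S : Finset V) : ℕ := (G.interedges S Sᶜ).card

/-- The conductance: number of edges leaving `S` divided by the volume of `S`. -/
noncomputable def conductance (S : Finset V) : ℝ := (G.boundary S : ℝ) / (G.volume S : ℝ)

end SimpleGraph

namespace EvoNibble

/-! ## Search trees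

Dictionaries are the balanced binary search trees `Std.TreeMap`; keys are compared with the linear
order on the vertex names. Lookup, insertion and deletion do a bounded number of elementary steps
at each node of one path that starts at the root, and each of them is charged
`depth + 1` steps, where `depth` is the actual depth of the tree at that moment. -/

/-- The number of levels of a binary tree. -/
def treeDepth {α β : Type*} : Std.DTreeMap.Internal.Impl α (fun _ => β) → ℕ
  | .leaf => 0
  | .inner _ _ _ l r => max (treeDepth l) (treeDepth r) + 1

/-- The number of steps charged for one operation on the dictionary `t`. -/
def dictCost {α β : Type*} [Ord α] (t : Std.TreeMap α β) : ℕ := treeDepth t.inner.inner + 1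

/-! ## The state of the algorithm, with a step counter -/

/-- The memory of `GenerateSample`. -/
structure Machine (V : Type*) [LinearOrder V] where
  /-- the current location of the random walk particle -/
  pos : V
  /-- membership dictionary: the vertices in the current set `S` -/
  mem : Std.TreeMap V Unit
  /-- boundary dictionary: stores `e(y, S)` for each `y` in the two-sided vertex boundary of `S` -/
  bd : Std.TreeMap V ℕ
  /-- the current value of the volume of `S` -/
  vol : ℕ
  /-- the current value of the number of edges leaving `S` -/
  bdry : ℕ
  /-- the cost of the sample path so far -/
  cost : ℕ
  /-- the number of steps performed so far -/
  work : ℕ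

section Deterministic

variable {V : Type*} [Fintype V] [LinearOrder V] (G : SimpleGraph V) [DecidableRel G.Adj]

namespace Machine

/-- Charge `k` steps. -/
def charge (s : Machine V) (k : ℕ) : Machine V := { s with work := s.work + k }

/-- The current set as a finite set. -/
def toFinset (s : Machine V) : Finset V := s.mem.keys.toFinset

/-- `e(y, S)`, read off from the two dictionaries. -/
def edgesTo (s : Machine V) (y : V) : ℕ :=
  match s.bd[y]? with
  | some k => k
  | none => if s.mem.contains y then G.degree y else 0

/-- `p(y, S) = (e(y, S) / d(y) + 1(y ∈ S)) / 2`, read off from the two dictionaries. -/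
noncomputable def prob (s : Machine V) (y : V) : ℝ :=
  ((s.edgesTo G y : ℝ) / (G.degree y : ℝ) + if s.mem.contains y then 1 else 0) / 2

/-- The charge for computing `1(y ∈ S)`, `e(y, S)` or `p(y, S)`: one lookup in each dictionary and
at most four further steps (degree query and arithmetic). -/
def lookupCost (s : Machine V) : ℕ := dictCost s.mem + dictCost s.bd + 4

/-- Record `e(z, S) = k`: put `z` into the boundary dictionary with value `k` if `z` belongs to the
two-sided boundary of `S`, and remove it from this dictionary otherwise. -/
def refresh (s : Machine V) (z : V) (k : ℕ) : Machine V :=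
  let onBoundary : Bool := if s.mem.contains z then k < G.degree z else 0 < k
  { s with
    bd := if onBoundary then s.bd.insert z k else s.bd.erase z
    work := s.work + s.lookupCost + dictCost s.bd }

/-- Add `y` to the current set if it is not there, and remove it if it is there. All entries of the
boundary dictionary at `y` and at the neighbours of `y` are updated; listing the neighbours of `y`
takes `d(y) + 1` steps. -/
def toggle (s : Machine V) (y : V) : Machine V :=
  let e := s.edgesTo G y
  let inside := s.mem.contains y
  let s₁ : Machine V :=
    { s with
      mem := if inside then s.mem.erase y else s.mem.insert y ()
      vol := if inside then s.vol - G.degree y else s.vol + G.degree y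
      bdry := if inside then s.bdry + 2 * e - G.degree y else s.bdry + G.degree y - 2 * e
      work := s.work + s.lookupCost + dictCost s.mem + (G.degree y + 1) }
  ((G.neighborFinset y).sort (· ≤ ·)).foldl
    (fun s z =>
      (s.charge s.lookupCost).refresh G z
        (if inside then s.edgesTo G z - 1 else s.edgesTo G z + 1))
    (s₁.refresh G y e)

/-- The machine after the data structures have been set up for the set `{x}`. -/
def init (x : V) : Machine V :=
  Machine.toggle G
    { pos := x, mem := ∅, bd := ∅, vol := 0, bdry := 0, cost := G.degree x, work := 6 } x

/-- The bookkeeping of stage 1, once the new walk position `x` and the list `D` of vertices to add or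
remove are selected. The charge accounts for the walk step, the lookup of `p(x, S)`, the choice of
the threshold, the iteration over the boundary with one lookup and one comparison for each
boundary vertex, and the update of the list and of the totals. -/
def stageOne (s : Machine V) (x : V) (D : List V) : Machine V :=
  { s with
    pos := x
    cost := s.cost + ((D.map fun y => G.degree y).sum + s.bdry)
    work := s.work + (6 + s.lookupCost + s.bd.size * (s.lookupCost + 4)) }

/-- Stage 2: update the set by adding or removing the vertices in `D`. -/
def stageTwo (s : Machine V) (D : List V) : Machine V :=
  (D.foldl (fun s y => s.toggle G y) s).charge 4

/-- The list of the boundary vertices whose membership changes when the current set `S` is replaced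
by `{y | p(y, S) ≥ z}`. -/
noncomputable def changes (s : Machine V) (z : ℝ) : List V :=
  s.bd.keys.filter fun y => decide (z ≤ s.prob G y) != s.mem.contains y

end Machine

end Deterministic

/-! ## Random choices -/

noncomputable section

open Classical in
/-- One step of the lazy random walk: stay with probability `1/2`, otherwise move to a uniformly
random neighbour. (At an isolated vertex the walk stays; such vertices are never reached.) -/
def walkStep {V : Type*} [Fintype V] (G : SimpleGraph V) [DecidableRel G.Adj] (x : V) : PMF V :=
  (PMF.uniformOfFintype Bool).bind fun b =>
    if h : b = true ∧ (G.neighborFinset x).Nonempty then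
      PMF.uniformOfFinset (G.neighborFinset x) h.2
    else PMF.pure x

section ChooseD

variable {V : Type*} [Fintype V] [LinearOrder V] (G : SimpleGraph V) [DecidableRel G.Adj]

theorem measurable_changes (s : Machine V) (a : ℝ) :
    @Measurable unitInterval (List V) _ ⊤ (fun u => s.changes G (a * u)) := by
  let _ : MeasurableSpace (List V) := ⊤
  unfold Machine.changes
  induction s.bd.keys with
  | nil => exact measurable_const
  | cons y l ih =>
    simp only [List.filter_cons]
    refine Measurable.ite ?_ (Measurable.comp (g := List.cons y) measurable_from_top ih) ih
    have hm : MeasurableSet {u : unitInterval | a * (u : ℝ) ≤ s.prob G y} :=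
      measurableSet_le (by fun_prop) measurable_const
    by_cases hc : s.mem.contains y = true
    · convert hm.compl using 1
      ext u
      simp [hc]
    · convert hm using 1
      ext u
      simp [hc]

/-- The law of the list `D` when the threshold `Z` is uniform on `[0, p(x, S)]`; here
`Z = p(x, S) * U` with `U` uniform on the unit interval. -/
def chooseChanges (s : Machine V) (x : V) : PMF (List V) :=
  letI : MeasurableSpace (List V) := ⊤
  letI : MeasurableSingletonClass (List V) := ⟨fun _ => trivial⟩
  haveI : Countable V := Finite.to_countable
  haveI : MeasureTheory.IsProbabilityMeasure
      ((MeasureTheory.volume : MeasureTheory.Measure unitInterval).map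
        (fun u : unitInterval => s.changes G (s.prob G x * (u : ℝ)))) :=
    MeasureTheory.Measure.isProbabilityMeasure_map (measurable_changes G s (s.prob G x)).aemeasurable
  ((MeasureTheory.volume : MeasureTheory.Measure unitInterval).map
    (fun u : unitInterval => s.changes G (s.prob G x * (u : ℝ)))).toPMF

end ChooseD

/-! ## `GenerateSample` -/

section GenerateSample

variable {V : Type*} [Fintype V] [LinearOrder V] (G : SimpleGraph V) [DecidableRel G.Adj]

/-- `θ_T = √(4 T⁻¹ log μ(V))`, with the convention that `θ_0 = ∞`. -/
def theta (T : ℕ) : EReal :=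
  if T = 0 then ⊤
  else ((Real.sqrt (4 * (T : ℝ)⁻¹ * Real.log (G.volume Finset.univ)) : ℝ) : EReal)

open Classical in
/-- The loop of `GenerateSample` with `k` steps left to do, budget `B` and target conductance `θ`.
The result is the output set together with the number of steps performed. -/
def run (B : ℝ) (θ : EReal) : ℕ → Machine V → PMF (Finset V × ℕ)
  | 0, s => PMF.pure (s.toFinset, s.work)
  | k + 1, s =>
    (walkStep G s.pos).bind fun x =>
      (chooseChanges G s x).bind fun D =>
        let s₁ := s.stageOne G x D
        if B < s₁.cost then PMF.pure (symmDiff s₁.toFinset D.toFinset, s₁.work)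
        else
          let s₂ := s₁.stageTwo G D
          if (((s₂.bdry : ℝ) / (s₂.vol : ℝ) : ℝ) : EReal) < θ then
            PMF.pure (s₂.toFinset, s₂.work)
          else run B θ k s₂

open Classical in
/-- `GenerateSample(x, T, B)`: sample the volume-biased evolving set process started from `{x}`
until the first time `t` at which the conductance is less than `θ_T`, or `t = T`, or the cost of the
sample path exceeds `B`. If this happens at time `0`, nothing has to be set up. -/
def generateSample (x : V) (T : ℕ) (B : ℝ) : PMF (Finset V × ℕ) :=
  if (G.conductance {x} : EReal) < theta G T ∨ T = 0 ∨ B < G.degree x then PMF.pure ({x}, 6)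
  else run G B (theta G T) T (Machine.init G x)

end GenerateSample

/-! ## `EvoNibble` -/

section Main

variable {V : Type*} [Fintype V] [LinearOrder V] (G : SimpleGraph V) [DecidableRel G.Adj]

/-- A random vertex, `P(X = x) = d(x) / μ(V)`. -/
def startVertex (hG : 0 < G.volume Finset.univ) : PMF V :=
  PMF.normalize (fun x => (G.degree x : ℝ≥0∞))
    (by
      rw [tsum_fintype, ← Nat.cast_sum]
      exact_mod_cast hG.ne')
    (by
      rw [tsum_fintype, ← Nat.cast_sum]
      exact ENNReal.natCast_ne_top _)

/-- `J_max = ⌈log₂ μ(V)⌉`. -/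
def maxIndex : ℕ := ⌈Real.logb 2 (G.volume Finset.univ)⌉₊

/-- A random integer `J` from `[0, N]` with `P(J = j)` proportional to `2^{-j}`. -/
def budgetIndex (N : ℕ) : PMF (Fin (N + 1)) :=
  PMF.normalize (fun j => (2⁻¹ : ℝ≥0∞) ^ (j : ℕ))
    (by
      rw [ENNReal.summable.tsum_ne_zero_iff]
      exact ⟨0, by simp⟩)
    (by
      rw [tsum_fintype]
      exact ENNReal.sum_ne_top.2 fun j _ => ENNReal.pow_ne_top (by simp))

/-- `T = ⌊φ⁻¹ / 100⌋`. -/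
def timeLimit (φ : ℝ) : ℕ := ⌊φ⁻¹ / 100⌋₊

/-- `B_j = 8 γ 2^j` with `γ = 1 + 4 √(T log μ(V))`. -/
def budget (φ : ℝ) (j : ℕ) : ℝ :=
  8 * (1 + 4 * Real.sqrt (timeLimit φ * Real.log (G.volume Finset.univ))) * 2 ^ j

open Classical in
/-- `EvoNibble(φ)`: the joint law of the output set and of the number of steps performed. Choosing
`J` takes `J_max + 1` steps; the computation of the parameters, the choice of the starting vertex and
the final test take a constant number of steps. -/
def evoNibble (hG : 0 < G.volume Finset.univ) (φ : ℝ) : PMF (Finset V × ℕ) :=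
  (startVertex G hG).bind fun x =>
    (budgetIndex (maxIndex G)).bind fun j =>
      (generateSample G x (timeLimit φ) (budget G φ j)).bind fun r =>
        PMF.pure
          (if (G.conductance r.1 : EReal) ≤ 3 * theta G (timeLimit φ) ∧
              (G.volume r.1 : ℝ) ≤ 3 / 4 * G.volume Finset.univ then r.1 else ∅,
            r.2 + (maxIndex G + 1) + 16)

/-- The law of the output set of `EvoNibble(φ)`. -/
def output (hG : 0 < G.volume Finset.univ) (φ : ℝ) : PMF (Finset V) :=
  (evoNibble G hG φ).map Prod.fst

/-- The expected number of steps performed by `EvoNibble(φ)`. -/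
def expectedWork (hG : 0 < G.volume Finset.univ) (φ : ℝ) : ℝ≥0∞ :=
  ∑' r : Finset V × ℕ, evoNibble G hG φ r * (r.2 : ℝ≥0∞)

end Main

end

end EvoNibble

/-!
The sample path `S₀, S₁, …` of `GenerateSample` is a volume-biased evolving set process: by the
Diaconis–Fill coupling (`sum_degree_mul_expect_step`) the particle is always distributed over the
current set proportionally to the degrees, and a step replaces `S` by `{y | p(y, S) ≥ z}` with `z`
in `(0, 1]` and density `μ({y | p(y, S) ≥ z}) / μ(S)`.

*Overlap with a sparse set `A`.* Three facts about one step of the process are used. The average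
over the current set of the probability to escape from `A` in the remaining time does not increase
(`evolve_sum_degree_mul`, `lazyStep_escape_le`); started from the stationary law in `A` it is at
most `T φ / 2 ≤ 1 / 200` (`sum_degree_mul_escape_le`). The cost grows by `2 φ(S) μ(S)` on average
when the bias is removed (`evolve_volume_symmDiff`). The logarithm of the volume grows by at least
`(2 / 5) φ(S) ^ 2` on average (`le_evolve_volume_mul_log`), so that the expected sum of `φ(S_t) ^
2` is at most `(5 / 2) log μ(V)`. Hence with probability at least `3 / 8` a set of conductance
less than `θ_T` is found before time `T`, the expectation of `cost / μ(S_τ)` is at most `γ`, and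
most of the output lies in `A` with high probability. These estimates are added up in one
function, `potential`, which is a submartingale until the path stops (`potential_succ_le`), is at
most the value of the output when it stops (`potential_le_score`) and is at least `μ(S₀) (1 / 4 -
10 e)` at the start, for the escape probability `e` (`le_potential_singleton`). In
`potential_le_score` the choice of `J` enters: the budget covers the cost `c` with a probability
of order `γ / c`, and for a path with `c ≈ γ μ(S_τ)` this compensates the factor `μ(S_τ ∩ A)` up
to a constant, whatever the volume of the output is. `potential_le_run` is the induction over the
steps of the machine.

*Running time.* The dictionaries describe the current set correctly (`Represents`), so an update
at `y` takes `O(d(y))` dictionary operations and a scan of the boundary takes `O(∂(S))` of them.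
Both are paid for by the cost of the path, since `∂(S) ≥ 1` as long as the run continues. Balanced
trees have logarithmic depth (`pow_treeDepth_le`), so a run takes `O(B log μ(V))` steps
(`work_run_le`), and the expectation of the budget is `O(γ log μ(V))` because `P(J = j) ≤ 2 ^
(-j)`.

*Guarantee for every output.* This is the final test of the algorithm together with `T ≥ 1 / (200
φ)` if `T ≠ 0`, and `φ > 1 / 100` if `T = 0`.
-/

/-! ### Edge counts -/

namespace SimpleGraph

theorem volume_mono {V : Type*} [Fintype V] (G : SimpleGraph V) [DecidableRel G.Adj]
    {S T : Finset V} (h : S ⊆ T) : G.volume S ≤ G.volume T :=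
  Finset.sum_le_sum_of_subset h

variable {V : Type*} [Fintype V] [DecidableEq V] (G : SimpleGraph V) [DecidableRel G.Adj]

/-- The number `e(y, S)` of neighbours of `y` in `S`. -/
def edgesInto (S : Finset V) (y : V) : ℕ := (G.neighborFinset y ∩ S).card

theorem edgesInto_le_degree (S : Finset V) (y : V) : G.edgesInto S y ≤ G.degree y :=
  Finset.card_le_card Finset.inter_subset_left

theorem edgesInto_empty (y : V) : G.edgesInto ∅ y = 0 := by simp [edgesInto]

theorem edgesInto_add_compl (S : Finset V) (y : V) :
    G.edgesInto S y + G.edgesInto Sᶜ y = G.degree y := by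
  unfold edgesInto
  rw [← Finset.sdiff_eq_inter_compl, Finset.card_inter_add_card_sdiff,
    card_neighborFinset_eq_degree]

theorem edgesInto_insert {S : Finset V} {y : V} (hy : y ∉ S) (w : V) :
    G.edgesInto (insert y S) w = G.edgesInto S w + if G.Adj w y then 1 else 0 := by
  unfold edgesInto
  by_cases h : G.Adj w y
  · rw [Finset.inter_insert_of_mem (by simpa using h), Finset.card_insert_of_notMem (by simp [hy])]
    simp [h]
  · rw [Finset.inter_insert_of_notMem (by simpa using h)]
    simp [h]

theorem edgesInto_erase {S : Finset V} {y : V} (hy : y ∈ S) (w : V) :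
    G.edgesInto S w = G.edgesInto (S.erase y) w + if G.Adj w y then 1 else 0 := by
  conv_lhs => rw [← Finset.insert_erase hy]
  exact G.edgesInto_insert (Finset.notMem_erase y S) w

theorem edgesInto_erase_self (S : Finset V) (y : V) :
    G.edgesInto (S.erase y) y = G.edgesInto S y := by
  by_cases hy : y ∈ S
  · simp [G.edgesInto_erase hy y]
  · rw [Finset.erase_eq_of_notMem hy]

theorem sum_sum_neighborFinset {M : Type*} [AddCommMonoid M] (S : Finset V) (h : V → M) :
    ∑ y ∈ S, ∑ w ∈ G.neighborFinset y, h w = ∑ w, G.edgesInto S w • h w := by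
  calc ∑ y ∈ S, ∑ w ∈ G.neighborFinset y, h w
      = ∑ y ∈ S, ∑ w, if G.Adj y w then h w else 0 := by
        refine Finset.sum_congr rfl fun y _ => ?_
        rw [← Finset.sum_filter]
        refine Finset.sum_congr ?_ fun _ _ => rfl
        ext; simp
    _ = ∑ w, ∑ y ∈ S, if G.Adj y w then h w else 0 := Finset.sum_comm
    _ = _ := by
        refine Finset.sum_congr rfl fun w _ => ?_
        rw [← Finset.sum_filter, Finset.sum_const]
        have : S.filter (fun y => G.Adj y w) = G.neighborFinset w ∩ S := by
          ext v
          simp [G.adj_comm, and_comm]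
        rw [this, edgesInto]

theorem boundary_eq_sum (S : Finset V) : G.boundary S = ∑ y ∈ S, G.edgesInto Sᶜ y := by
  unfold boundary interedges Rel.interedges
  rw [Finset.card_filter, Finset.sum_product]
  refine Finset.sum_congr rfl fun y _ => ?_
  rw [← Finset.card_filter]
  unfold edgesInto
  congr 1
  ext v
  simp [and_comm]

theorem boundary_eq_sum_compl (S : Finset V) : G.boundary S = ∑ y ∈ Sᶜ, G.edgesInto S y := by
  rw [boundary_eq_sum]
  have h1 := G.sum_sum_neighborFinset S (fun w => if w ∈ Sᶜ then 1 else 0)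
  have h2 : ∀ y, (∑ w ∈ G.neighborFinset y, if w ∈ Sᶜ then 1 else 0) = G.edgesInto Sᶜ y := by
    intro y
    rw [← Finset.card_filter]
    unfold edgesInto
    congr 1
  simp only [h2] at h1
  rw [h1, ← Finset.sum_filter_add_sum_filter_not Finset.univ (· ∈ Sᶜ)]
  rw [Finset.sum_eq_zero (s := Finset.univ.filter (¬ · ∈ Sᶜ))]
  · rw [add_zero]
    refine Finset.sum_congr (by ext; simp) fun w hw => ?_
    simp only [hw, if_true, smul_eq_mul, mul_one]
  · intro w hw
    rw [Finset.mem_filter] at hw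
    simp only [hw.2, if_false, smul_zero]

theorem boundary_add_sum_edgesInto (S : Finset V) :
    G.boundary S + ∑ y ∈ S, G.edgesInto S y = G.volume S := by
  rw [boundary_eq_sum, ← Finset.sum_add_distrib]
  refine Finset.sum_congr rfl fun y _ => ?_
  rw [add_comm, edgesInto_add_compl]

theorem boundary_le_volume (S : Finset V) : G.boundary S ≤ G.volume S := by
  have := G.boundary_add_sum_edgesInto S
  omega

theorem volume_insert {S : Finset V} {y : V} (hy : y ∉ S) :
    G.volume (insert y S) = G.degree y + G.volume S := Finset.sum_insert hy

theorem volume_erase {S : Finset V} {y : V} (hy : y ∈ S) :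
    G.volume (S.erase y) + G.degree y = G.volume S := Finset.sum_erase_add _ _ hy

theorem boundary_insert {S : Finset V} {y : V} (hy : y ∉ S) :
    G.boundary (insert y S) + 2 * G.edgesInto S y = G.boundary S + G.degree y := by
  have h1 := G.boundary_add_sum_edgesInto S
  have h2 := G.boundary_add_sum_edgesInto (insert y S)
  rw [G.volume_insert hy, Finset.sum_insert hy, G.edgesInto_insert hy] at h2
  simp only [G.edgesInto_insert hy, Finset.sum_add_distrib] at h2
  have h3 : (∑ w ∈ S, if G.Adj w y then 1 else 0) = G.edgesInto S y := by
    rw [← Finset.card_filter]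
    unfold edgesInto
    congr 1
    ext v; simp [G.adj_comm, and_comm]
  rw [h3] at h2
  simp at h2
  omega

theorem boundary_erase {S : Finset V} {y : V} (hy : y ∈ S) :
    G.boundary (S.erase y) + G.degree y = G.boundary S + 2 * G.edgesInto S y := by
  have := G.boundary_insert (Finset.notMem_erase y S)
  rw [Finset.insert_erase hy, edgesInto_erase_self] at this
  omega

end SimpleGraph

namespace EvoNibble

/-! ### Depth of the search trees -/

/-- In a weight-balanced tree a subtree holds at most `3/4` of the leaves. -/
theorem pow_treeDepth_le {α β : Type*} {t : Std.DTreeMap.Internal.Impl α (fun _ => β)}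
    (ht : t.Balanced) : (4 / 3 : ℝ) ^ treeDepth t ≤ t.size + 1 := by
  induction ht with
  | leaf => simp [treeDepth, Std.DTreeMap.Internal.Impl.size]
  | @inner sz k v l r hl hr hb hs ihl ihr =>
    simp only [treeDepth, Std.DTreeMap.Internal.Impl.size, pow_succ]
    have hs' : (sz : ℝ) = l.size + 1 + r.size := by exact_mod_cast hs
    have key : 4 * (l.size + 1) ≤ 3 * (sz + 1) ∧ 4 * (r.size + 1) ≤ 3 * (sz + 1) := by
      rcases hb with hb | hb
      · omega
      · simp only [Std.DTreeMap.Internal.delta] at hb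
        omega
    have k1 : 4 * ((l.size : ℝ) + 1) ≤ 3 * (sz + 1) := by exact_mod_cast key.1
    have k2 : 4 * ((r.size : ℝ) + 1) ≤ 3 * (sz + 1) := by exact_mod_cast key.2
    rcases max_cases (treeDepth l) (treeDepth r) with ⟨h, -⟩ | ⟨h, -⟩ <;> rw [h] <;> linarith

theorem dictCost_le {α β : Type*} [Ord α] (t : Std.TreeMap α β) {n : ℕ} (hn : 2 ≤ n)
    (ht : t.size ≤ n) : (dictCost t : ℝ) ≤ 10 * Real.log n := by
  have h1 := pow_treeDepth_le t.inner.wf.balanced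
  have h2 : (t.inner.inner.size : ℝ) ≤ n := by exact_mod_cast ht
  have hn' : (2 : ℝ) ≤ n := by exact_mod_cast hn
  have h3 : (4 / 3 : ℝ) ^ treeDepth t.inner.inner ≤ (n : ℝ) ^ 2 := by nlinarith
  have h4 := Real.log_le_log (by positivity) h3
  rw [Real.log_pow, Real.log_pow] at h4
  have h5 : (1 / 4 : ℝ) ≤ Real.log (4 / 3) := by
    have := Real.one_sub_inv_le_log_of_pos (show (0 : ℝ) < 4 / 3 by norm_num)
    norm_num at this ⊢
    linarith
  have h6 : (1 / 2 : ℝ) ≤ Real.log n := by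
    have := Real.log_le_log (by norm_num) hn'
    linarith [Real.log_two_gt_d9]
  have h7 : (treeDepth t.inner.inner : ℝ) * (1 / 4) ≤ treeDepth t.inner.inner * Real.log (4 / 3) :=
    mul_le_mul_of_nonneg_left h5 (Nat.cast_nonneg _)
  unfold dictCost
  push_cast at h4 ⊢
  linarith

/-! ### Correctness of the data structures -/

namespace Machine

variable {V : Type*} [Fintype V] [LinearOrder V] (G : SimpleGraph V) [DecidableRel G.Adj]

/-- The entry that the boundary dictionary should have at `w` when the current set is `S` and
`e(w, S) = k`. -/
def entry (S : Finset V) (w : V) (k : ℕ) : Option ℕ :=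
  if (if w ∈ S then k < G.degree w else 0 < k) then some k else none

/-- The memory `s` describes the set `S` correctly. -/
structure Represents (s : Machine V) (S : Finset V) : Prop where
  mem : ∀ w, s.mem.contains w = decide (w ∈ S)
  bd : ∀ w, s.bd[w]? = entry G S w (G.edgesInto S w)
  vol : s.vol = G.volume S
  bdry : s.bdry = G.boundary S

variable {G}

theorem edgesTo_eq_of_entry {s : Machine V} {S : Finset V} {w : V} {k : ℕ}
    (hm : s.mem.contains w = decide (w ∈ S)) (hb : s.bd[w]? = entry G S w k)
    (hk : k ≤ G.degree w) : s.edgesTo G w = k := by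
  unfold edgesTo
  rw [hb, hm]
  unfold entry
  by_cases hw : w ∈ S <;> by_cases h : k < G.degree w <;> by_cases h0 : 0 < k <;>
    simp [hw, h, h0] <;> omega

theorem Represents.edgesTo {s : Machine V} {S : Finset V} (h : s.Represents G S) (w : V) :
    s.edgesTo G w = G.edgesInto S w :=
  edgesTo_eq_of_entry (h.mem w) (h.bd w) (G.edgesInto_le_degree S w)

theorem Represents.toFinset {s : Machine V} {S : Finset V} (h : s.Represents G S) :
    s.toFinset = S := by
  ext w
  unfold Machine.toFinset
  rw [List.mem_toFinset, Std.TreeMap.mem_keys, Std.TreeMap.mem_iff_contains, h.mem]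
  simp

theorem getElem?_bd_refresh (s : Machine V) (S : Finset V) (z : V) (k : ℕ)
    (hm : s.mem.contains z = decide (z ∈ S)) (w : V) :
    (s.refresh G z k).bd[w]? = if w = z then entry G S z k else s.bd[w]? := by
  unfold refresh entry
  rw [hm]
  by_cases hw : w = z
  · subst hw
    by_cases hS : w ∈ S <;> by_cases h : k < G.degree w <;> by_cases h0 : 0 < k <;>
      simp [hS, h, h0]
  · have hc : compare z w ≠ Ordering.eq := by simpa using fun h => hw h.symm
    by_cases hS : z ∈ S <;> by_cases h : k < G.degree z <;> by_cases h0 : 0 < k <;>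
      simp [hS, h, h0, hw, hc, Std.TreeMap.getElem?_insert, Std.TreeMap.getElem?_erase]

end Machine
end EvoNibble

namespace EvoNibble
namespace Machine

variable {V : Type*} [Fintype V] [LinearOrder V] (G : SimpleGraph V) [DecidableRel G.Adj]

/-- The update of the boundary dictionary at one neighbour `z` of a toggled vertex. -/
def shiftEntry (inside : Bool) (s : Machine V) (z : V) : Machine V :=
  (s.charge s.lookupCost).refresh G z
    (if inside then s.edgesTo G z - 1 else s.edgesTo G z + 1)

/-- The part of `toggle` that precedes the changes to the boundary dictionary. -/
def toggleMem (s : Machine V) (y : V) : Machine V :=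
  { s with
    mem := if s.mem.contains y then s.mem.erase y else s.mem.insert y ()
    vol := if s.mem.contains y then s.vol - G.degree y else s.vol + G.degree y
    bdry := if s.mem.contains y then s.bdry + 2 * s.edgesTo G y - G.degree y
      else s.bdry + G.degree y - 2 * s.edgesTo G y
    work := s.work + s.lookupCost + dictCost s.mem + (G.degree y + 1) }

/-- The part of `toggle` that precedes the updates at the neighbours. -/
def toggleSelf (s : Machine V) (y : V) : Machine V :=
  (s.toggleMem G y).refresh G y (s.edgesTo G y)

theorem toggle_eq (s : Machine V) (y : V) :
    s.toggle G y = ((G.neighborFinset y).sort (· ≤ ·)).foldl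
      (shiftEntry G (s.mem.contains y)) (s.toggleSelf G y) := rfl

/-- The memory `s` with the particle moved to `x`. -/
def atPos (s : Machine V) (x : V) : Machine V := { s with pos := x }

theorem foldl_shiftEntry_atPos (b : Bool) (l : List V) (s : Machine V) (x : V) :
    l.foldl (shiftEntry G b) (s.atPos x) = (l.foldl (shiftEntry G b) s).atPos x := by
  induction l generalizing s with
  | nil => rfl
  | cons z l ih => exact ih (shiftEntry G b s z)

theorem toggle_atPos (s : Machine V) (x y : V) :
    (s.atPos x).toggle G y = (s.toggle G y).atPos x :=
  foldl_shiftEntry_atPos G _ _ (s.toggleSelf G y) x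

theorem foldl_toggle_atPos (D : List V) (s : Machine V) (x : V) :
    D.foldl (fun s y => s.toggle G y) (s.atPos x)
      = (D.foldl (fun s y => s.toggle G y) s).atPos x := by
  induction D generalizing s with
  | nil => rfl
  | cons y D ih => rw [List.foldl_cons, List.foldl_cons, toggle_atPos, ih]

theorem stageTwo_atPos (s : Machine V) (D : List V) (x : V) :
    (s.atPos x).stageTwo G D = (s.stageTwo G D).atPos x := by
  unfold stageTwo
  rw [foldl_toggle_atPos]
  rfl

variable {G}

theorem foldl_shiftEntry_unchanged (b : Bool) (l : List V) (s : Machine V) :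
    (l.foldl (shiftEntry G b) s).mem = s.mem ∧ (l.foldl (shiftEntry G b) s).vol = s.vol ∧
    (l.foldl (shiftEntry G b) s).bdry = s.bdry ∧ (l.foldl (shiftEntry G b) s).cost = s.cost := by
  induction l generalizing s with
  | nil => exact ⟨rfl, rfl, rfl, rfl⟩
  | cons z l ih => exact ih (shiftEntry G b s z)

theorem getElem?_bd_foldl_shiftEntry (b : Bool) (S : Finset V) {l : List V} (hl : l.Nodup)
    (s : Machine V) (f : V → ℕ) (hm : ∀ w, s.mem.contains w = decide (w ∈ S))
    (hb : ∀ w, s.bd[w]? = entry G S w (f w)) (hf : ∀ w ∈ l, f w ≤ G.degree w) (w : V) :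
    (l.foldl (shiftEntry G b) s).bd[w]?
      = entry G S w (if w ∈ l then (if b then f w - 1 else f w + 1) else f w) := by
  induction l generalizing s f with
  | nil => simpa using hb w
  | cons z l ih =>
    rw [List.nodup_cons] at hl
    rw [List.foldl_cons]
    have he : s.edgesTo G z = f z := edgesTo_eq_of_entry (hm z) (hb z) (hf z (by simp))
    have hstep : ∀ v, (shiftEntry G b s z).bd[v]? =
        entry G S v (Function.update f z (if b then f z - 1 else f z + 1) v) := by
      intro v
      unfold shiftEntry
      refine (getElem?_bd_refresh (s.charge s.lookupCost) S z _ (hm z) v).trans ?_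
      rw [he]
      by_cases hv : v = z
      · subst hv; simp
      · rw [if_neg hv, Function.update_of_ne hv]
        exact hb v
    rw [ih hl.2 (shiftEntry G b s z) _ hm hstep]
    · by_cases hw : w = z
      · subst hw; simp [hl.1]
      · simp [hw]
    · intro v hv
      have : v ≠ z := fun h => hl.1 (h ▸ hv)
      simpa [this] using hf v (by simp [hv])

theorem Represents.toggle {s : Machine V} {S : Finset V} (h : s.Represents G S) (y : V) :
    (s.toggle G y).Represents G (symmDiff S {y}) := by
  rw [toggle_eq]
  obtain ⟨u1, u2, u3, -⟩ := foldl_shiftEntry_unchanged (G := G) (s.mem.contains y)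
    ((G.neighborFinset y).sort (· ≤ ·)) (s.toggleSelf G y)
  have hmem : ∀ w, (s.toggleSelf G y).mem.contains w = decide (w ∈ symmDiff S {y}) := by
    intro w
    change (if s.mem.contains y then s.mem.erase y else s.mem.insert y ()).contains w = _
    rw [h.mem y]
    by_cases hw : w = y
    · subst hw
      by_cases hS : w ∈ S <;>
        simp [hS, Finset.mem_symmDiff, Std.TreeMap.contains_erase, Std.TreeMap.contains_insert]
    · have hc : compare y w ≠ Ordering.eq := by simpa using fun h => hw h.symm
      by_cases hS : y ∈ S <;>
        simp [hS, hw, hc, Finset.mem_symmDiff, Std.TreeMap.contains_erase,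
          Std.TreeMap.contains_insert, h.mem]
  have hb : ∀ w, (s.toggleSelf G y).bd[w]? = entry G (symmDiff S {y}) w (G.edgesInto S w) := by
    intro w
    refine (getElem?_bd_refresh (G := G) (s.toggleMem G y) (symmDiff S {y}) y _ (hmem y) w).trans ?_
    rw [h.edgesTo]
    by_cases hw : w = y
    · subst hw; simp
    · rw [if_neg hw]
      refine (h.bd w).trans ?_
      unfold entry
      simp [Finset.mem_symmDiff, hw]
  refine ⟨fun w => by rw [u1]; exact hmem w, fun w => ?_, ?_, ?_⟩
  · rw [getElem?_bd_foldl_shiftEntry _ (symmDiff S {y}) (Finset.sort_nodup _ _) _ _ hmem hb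
      fun w _ => G.edgesInto_le_degree S w, h.mem y]
    congr 1
    by_cases hS : y ∈ S
    · have e1 : symmDiff S {y} = S.erase y := by
        ext v; by_cases hv : v = y <;> simp [Finset.mem_symmDiff, hv, hS]
      rw [e1, G.edgesInto_erase hS w]
      by_cases ha : G.Adj w y <;> simp [hS, ha, G.adj_comm y w]
    · have e1 : symmDiff S {y} = insert y S := by
        ext v; by_cases hv : v = y <;> simp [Finset.mem_symmDiff, hv, hS]
      rw [e1, G.edgesInto_insert hS w]
      by_cases ha : G.Adj w y <;> simp [hS, ha, G.adj_comm y w]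
  · rw [u2]
    change (if s.mem.contains y then s.vol - G.degree y else s.vol + G.degree y) = _
    rw [h.mem y, h.vol]
    by_cases hS : y ∈ S
    · have e1 : symmDiff S {y} = S.erase y := by
        ext v; by_cases hv : v = y <;> simp [Finset.mem_symmDiff, hv, hS]
      have := G.volume_erase hS
      simp only [hS, e1, decide_true, if_true]
      omega
    · have e1 : symmDiff S {y} = insert y S := by
        ext v; by_cases hv : v = y <;> simp [Finset.mem_symmDiff, hv, hS]
      have := G.volume_insert hS
      simp only [hS, e1, decide_false, Bool.false_eq_true, if_false]
      omega
  · rw [u3]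
    change (if s.mem.contains y then s.bdry + 2 * s.edgesTo G y - G.degree y
        else s.bdry + G.degree y - 2 * s.edgesTo G y) = _
    rw [h.mem y, h.bdry, h.edgesTo]
    by_cases hS : y ∈ S
    · have e1 : symmDiff S {y} = S.erase y := by
        ext v; by_cases hv : v = y <;> simp [Finset.mem_symmDiff, hv, hS]
      have := G.boundary_erase hS
      simp only [hS, e1, decide_true, if_true]
      omega
    · have e1 : symmDiff S {y} = insert y S := by
        ext v; by_cases hv : v = y <;> simp [Finset.mem_symmDiff, hv, hS]
      have := G.boundary_insert hS
      simp only [hS, e1, decide_false, Bool.false_eq_true, if_false]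
      omega

theorem Represents.foldl_toggle {s : Machine V} {S : Finset V} (h : s.Represents G S)
    {D : List V} (hD : D.Nodup) :
    (D.foldl (fun s y => s.toggle G y) s).Represents G (symmDiff S D.toFinset) := by
  induction D generalizing s S with
  | nil => rwa [List.toFinset_nil, show symmDiff S ∅ = S from symmDiff_bot S]
  | cons y D ih =>
    rw [List.nodup_cons] at hD
    have := ih (h.toggle y) hD.2
    rw [List.foldl_cons]
    convert this using 1
    rw [symmDiff_assoc, List.toFinset_cons]
    congr 1
    ext v
    by_cases hv : v = y
    · subst hv; simp [Finset.mem_symmDiff, hD.1]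
    · simp [Finset.mem_symmDiff, hv]

theorem Represents.charge {s : Machine V} {S : Finset V} (h : s.Represents G S) (k : ℕ) :
    (s.charge k).Represents G S := ⟨h.mem, h.bd, h.vol, h.bdry⟩

theorem Represents.atPos {s : Machine V} {S : Finset V} (h : s.Represents G S) (x : V) :
    (s.atPos x).Represents G S := ⟨h.mem, h.bd, h.vol, h.bdry⟩

theorem Represents.stageOne {s : Machine V} {S : Finset V} (h : s.Represents G S) (x : V)
    (D : List V) : (s.stageOne G x D).Represents G S := ⟨h.mem, h.bd, h.vol, h.bdry⟩

theorem Represents.stageTwo {s : Machine V} {S : Finset V} (h : s.Represents G S)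
    {D : List V} (hD : D.Nodup) : (s.stageTwo G D).Represents G (symmDiff S D.toFinset) :=
  (h.foldl_toggle hD).charge 4

theorem cost_toggle (s : Machine V) (y : V) : (s.toggle G y).cost = s.cost := by
  rw [toggle_eq]
  exact (foldl_shiftEntry_unchanged _ _ _).2.2.2

theorem cost_stageTwo (s : Machine V) (D : List V) : (s.stageTwo G D).cost = s.cost := by
  change (D.foldl (fun s y => s.toggle G y) s).cost = s.cost
  induction D generalizing s with
  | nil => rfl
  | cons y D ih => rw [List.foldl_cons, ih, cost_toggle]

theorem cost_init (x : V) : (init G x).cost = G.degree x := cost_toggle _ _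

theorem represents_init (x : V) : (init G x).Represents G {x} := by
  have h0 : Represents G
      { pos := x, mem := ∅, bd := ∅, vol := 0, bdry := 0, cost := G.degree x, work := 6 }
      (∅ : Finset V) := by
    refine ⟨fun w => by simp, fun w => ?_, by simp [SimpleGraph.volume],
      by simp [SimpleGraph.boundary_eq_sum]⟩
    simp [entry, SimpleGraph.edgesInto_empty]
  have := h0.toggle x
  rwa [show symmDiff (∅ : Finset V) {x} = {x} from bot_symmDiff _] at this

theorem changes_nodup (s : Machine V) (z : ℝ) : (s.changes G z).Nodup :=
  Std.TreeMap.nodup_keys.filter _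

/-- The vertices in the boundary dictionary are the ends of the edges that leave `S`. -/
theorem Represents.mem_keys_bd {s : Machine V} {S : Finset V} (h : s.Represents G S) (w : V) :
    w ∈ s.bd.keys ↔ if w ∈ S then 0 < G.edgesInto Sᶜ w else 0 < G.edgesInto S w := by
  have := G.edgesInto_add_compl S w
  rw [Std.TreeMap.mem_keys, Std.TreeMap.mem_iff_isSome_getElem?, h.bd, entry]
  by_cases hw : w ∈ S
  · by_cases hk : G.edgesInto S w < G.degree w <;> simp [hw, hk] <;> omega
  · by_cases hk : 0 < G.edgesInto S w <;> simp [hw, hk]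

theorem Represents.size_bd_le {s : Machine V} {S : Finset V} (h : s.Represents G S) :
    s.bd.size ≤ 2 * G.boundary S := by
  rw [← Std.TreeMap.length_keys, ← List.toFinset_card_of_nodup Std.TreeMap.nodup_keys,
    Finset.card_eq_sum_ones]
  have hsplit : s.bd.keys.toFinset ⊆
      S.filter (fun w => 0 < G.edgesInto Sᶜ w) ∪ Sᶜ.filter (fun w => 0 < G.edgesInto S w) := by
    intro w hw
    rw [List.mem_toFinset, h.mem_keys_bd] at hw
    by_cases hS : w ∈ S <;> simpa [hS] using hw
  refine (Finset.sum_le_sum_of_subset hsplit).trans ?_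
  rw [Finset.sum_union (Finset.disjoint_left.2 fun w h1 h2 => by simp at h1 h2; exact h2.1 h1.1),
    two_mul]
  refine Nat.add_le_add ?_ ?_
  · rw [G.boundary_eq_sum]
    refine (Finset.sum_le_sum fun w hw => (Finset.mem_filter.1 hw).2).trans ?_
    exact Finset.sum_le_sum_of_subset (Finset.filter_subset _ _)
  · rw [G.boundary_eq_sum_compl]
    refine (Finset.sum_le_sum fun w hw => (Finset.mem_filter.1 hw).2).trans ?_
    exact Finset.sum_le_sum_of_subset (Finset.filter_subset _ _)

end Machine
end EvoNibble

/-! ### Running time along a sample path -/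

namespace SimpleGraph

theorem two_le_volume_of_boundary_eq_zero {V : Type*} [Fintype V] [DecidableEq V]
    (G : SimpleGraph V) [DecidableRel G.Adj] {S : Finset V} (h0 : 0 < G.volume S)
    (hb : G.boundary S = 0) : 2 ≤ G.volume S := by
  obtain ⟨x, hx, hd⟩ := Finset.exists_ne_zero_of_sum_ne_zero h0.ne'
  have hb' := hb
  rw [boundary_eq_sum, Finset.sum_eq_zero_iff] at hb'
  have hin : G.edgesInto S x = G.degree x := by
    have := G.edgesInto_add_compl S x
    have := hb' x hx
    omega
  obtain ⟨w, hw⟩ : (G.neighborFinset x ∩ S).Nonempty := by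
    rw [← Finset.card_pos]
    change 0 < G.edgesInto S x
    omega
  rw [Finset.mem_inter, mem_neighborFinset] at hw
  have hwd : 0 < G.degree w := (G.degree_pos_iff_exists_adj w).2 ⟨x, hw.1.symm⟩
  have : G.volume {x, w} ≤ G.volume S := G.volume_mono (by
    intro v
    simp only [Finset.mem_insert, Finset.mem_singleton]
    rintro (rfl | rfl)
    exacts [hx, hw.2])
  rw [volume, Finset.sum_pair hw.1.ne] at this
  omega

theorem two_le_volume_univ {V : Type*} [Fintype V] [DecidableEq V]
    (G : SimpleGraph V) [DecidableRel G.Adj] (h0 : 0 < G.volume Finset.univ) :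
    2 ≤ G.volume Finset.univ :=
  G.two_le_volume_of_boundary_eq_zero h0 (by simp [boundary_eq_sum_compl])

end SimpleGraph

namespace EvoNibble

section

variable {V : Type*} [Fintype V] (G : SimpleGraph V) [DecidableRel G.Adj]

/-- A bound for the number of steps charged for one dictionary operation. -/
noncomputable def opBound : ℝ := 10 * Real.log (G.volume Finset.univ)

theorem half_lt_log_volume (hm : 2 ≤ G.volume Finset.univ) :
    1 / 2 < Real.log (G.volume Finset.univ) := by
  have := Real.log_le_log (by norm_num) (show (2 : ℝ) ≤ G.volume Finset.univ by exact_mod_cast hm)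
  linarith [Real.log_two_gt_d9]

theorem one_le_opBound (hm : 2 ≤ G.volume Finset.univ) : 1 ≤ opBound G := by
  unfold opBound
  linarith [half_lt_log_volume G hm]

theorem theta_pos (hm : 2 ≤ G.volume Finset.univ) (T : ℕ) : 0 < theta G T := by
  unfold theta
  split_ifs with h
  · exact EReal.zero_lt_top
  · have h1 := half_lt_log_volume G hm
    have h2 : (0 : ℝ) < T := by exact_mod_cast Nat.pos_of_ne_zero h
    exact_mod_cast Real.sqrt_pos.2 (by positivity)

end

namespace Machine

variable {V : Type*} [Fintype V] [LinearOrder V] (G : SimpleGraph V) [DecidableRel G.Adj]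

/-- Isolated vertices do not occur in the dictionaries. -/
def Supported (s : Machine V) : Prop :=
  (∀ w, s.mem.contains w → 0 < G.degree w) ∧ ∀ w, s.bd.contains w → 0 < G.degree w

variable {G}

theorem size_le_volume {β : Type*} (t : Std.TreeMap V β) (h : ∀ w, t.contains w → 0 < G.degree w) :
    t.size ≤ G.volume Finset.univ := by
  rw [← Std.TreeMap.length_keys, ← List.toFinset_card_of_nodup Std.TreeMap.nodup_keys,
    Finset.card_eq_sum_ones]
  refine (Finset.sum_le_sum (g := fun w => G.degree w) fun w hw => ?_).trans
    (G.volume_mono (Finset.subset_univ _))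
  rw [List.mem_toFinset, Std.TreeMap.mem_keys, Std.TreeMap.mem_iff_contains] at hw
  exact h w hw

section

variable (hm : 2 ≤ G.volume Finset.univ)
include hm

theorem Supported.dictCost_mem_le {s : Machine V} (h : s.Supported G) :
    (dictCost s.mem : ℝ) ≤ opBound G := dictCost_le _ hm (size_le_volume _ h.1)

theorem Supported.dictCost_bd_le {s : Machine V} (h : s.Supported G) :
    (dictCost s.bd : ℝ) ≤ opBound G := dictCost_le _ hm (size_le_volume _ h.2)

theorem Supported.lookupCost_le {s : Machine V} (h : s.Supported G) :
    (s.lookupCost : ℝ) ≤ 6 * opBound G := by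
  have h1 := h.dictCost_mem_le hm
  have h2 := h.dictCost_bd_le hm
  have h3 := one_le_opBound G hm
  unfold lookupCost
  push_cast
  linarith

theorem Supported.refresh {s : Machine V} (h : s.Supported G) {z : V} (hz : 0 < G.degree z)
    (k : ℕ) : (s.refresh G z k).Supported G ∧
      ((s.refresh G z k).work : ℝ) ≤ s.work + 7 * opBound G := by
  refine ⟨⟨h.1, fun w => ?_⟩, ?_⟩
  · have : (s.refresh G z k).bd = s.bd.insert z k ∨ (s.refresh G z k).bd = s.bd.erase z := by
      unfold Machine.refresh
      dsimp only
      split_ifs <;> simp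
    rcases this with e | e <;> rw [e]
    · rw [Std.TreeMap.contains_insert]
      simp only [Bool.or_eq_true, beq_iff_eq, compare_eq_iff_eq]
      rintro (rfl | hw)
      exacts [hz, h.2 w hw]
    · rw [Std.TreeMap.contains_erase]
      simp only [Bool.and_eq_true]
      exact fun hw => h.2 w hw.2
  · have h1 := h.lookupCost_le hm
    have h2 := h.dictCost_bd_le hm
    change ((s.work + s.lookupCost + dictCost s.bd : ℕ) : ℝ) ≤ _
    push_cast
    linarith

theorem Supported.foldl_shiftEntry (b : Bool) {l : List V} (hl : ∀ z ∈ l, 0 < G.degree z)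
    {s : Machine V} (h : s.Supported G) : (l.foldl (shiftEntry G b) s).Supported G ∧
      ((l.foldl (shiftEntry G b) s).work : ℝ) ≤ s.work + 13 * opBound G * l.length := by
  induction l generalizing s with
  | nil => simpa using h
  | cons z l ih =>
    have h0 : (s.charge s.lookupCost).Supported G := h
    obtain ⟨h1, h2⟩ := h0.refresh hm (hl z (by simp))
      (if b then s.edgesTo G z - 1 else s.edgesTo G z + 1)
    obtain ⟨h3, h4⟩ := ih (fun w hw => hl w (by simp [hw])) (s := shiftEntry G b s z) h1
    refine ⟨h3, h4.trans ?_⟩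
    have h5 : ((s.charge s.lookupCost).work : ℝ) ≤ s.work + 6 * opBound G := by
      have := h.lookupCost_le hm
      change ((s.work + s.lookupCost : ℕ) : ℝ) ≤ _
      push_cast
      linarith
    change ((shiftEntry G b s z).work : ℝ) ≤ _ at h2
    rw [List.length_cons]
    push_cast
    linarith

theorem Supported.toggle {s : Machine V} (h : s.Supported G) {y : V} (hy : 0 < G.degree y) :
    (s.toggle G y).Supported G ∧
      ((s.toggle G y).work : ℝ) ≤ s.work + 29 * opBound G * G.degree y := by
  have h0 : (s.toggleMem G y).Supported G := by
    refine ⟨fun w => ?_, h.2⟩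
    change (if s.mem.contains y then s.mem.erase y else s.mem.insert y ()).contains w = true → _
    split_ifs
    · rw [Std.TreeMap.contains_erase]
      simp only [Bool.and_eq_true]
      exact fun hw => h.1 w hw.2
    · rw [Std.TreeMap.contains_insert]
      simp only [Bool.or_eq_true, beq_iff_eq, compare_eq_iff_eq]
      rintro (rfl | hw)
      exacts [hy, h.1 w hw]
  obtain ⟨h1, h2⟩ := h0.refresh hm hy (s.edgesTo G y)
  have hl : ∀ z ∈ (G.neighborFinset y).sort (· ≤ ·), 0 < G.degree z := by
    intro z hz
    rw [Finset.mem_sort, SimpleGraph.mem_neighborFinset] at hz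
    exact (G.degree_pos_iff_exists_adj z).2 ⟨y, hz.symm⟩
  obtain ⟨h3, h4⟩ := Supported.foldl_shiftEntry hm (s.mem.contains y) hl
    (s := s.toggleSelf G y) h1
  rw [toggle_eq]
  refine ⟨h3, h4.trans ?_⟩
  rw [Finset.length_sort, SimpleGraph.card_neighborFinset_eq_degree]
  have h5 : ((s.toggleMem G y).work : ℝ) ≤ s.work + 7 * opBound G + G.degree y + 1 := by
    have h6 := h.lookupCost_le hm
    have h7 := h.dictCost_mem_le hm
    change ((s.work + s.lookupCost + dictCost s.mem + (G.degree y + 1) : ℕ) : ℝ) ≤ _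
    push_cast
    linarith
  change ((s.toggleSelf G y).work : ℝ) ≤ _ at h2
  have h8 := one_le_opBound G hm
  have h9 : (1 : ℝ) ≤ G.degree y := by exact_mod_cast hy
  nlinarith

theorem Supported.foldl_toggle {D : List V} (hD : ∀ y ∈ D, 0 < G.degree y) {s : Machine V}
    (h : s.Supported G) : (D.foldl (fun s y => s.toggle G y) s).Supported G ∧
      ((D.foldl (fun s y => s.toggle G y) s).work : ℝ) ≤
        s.work + 29 * opBound G * (D.map fun y => G.degree y).sum := by
  induction D generalizing s with
  | nil => simpa using h
  | cons y D ih =>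
    obtain ⟨h1, h2⟩ := h.toggle hm (hD y (by simp))
    obtain ⟨h3, h4⟩ := ih (fun w hw => hD w (by simp [hw])) h1
    rw [List.foldl_cons]
    refine ⟨h3, h4.trans ?_⟩
    rw [List.map_cons, List.sum_cons]
    push_cast
    linarith

theorem supported_init {x : V} (hx : 0 < G.degree x) : (init G x).Supported G ∧
    ((init G x).work : ℝ) ≤ 36 * opBound G * G.degree x := by
  have h0 : Supported G
      { pos := x, mem := ∅, bd := ∅, vol := 0, bdry := 0, cost := G.degree x, work := 6 } :=
    ⟨fun w => by simp, fun w => by simp⟩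
  obtain ⟨h1, h2⟩ := h0.toggle hm hx
  refine ⟨h1, h2.trans ?_⟩
  have h8 := one_le_opBound G hm
  have h9 : (1 : ℝ) ≤ G.degree x := by exact_mod_cast hx
  push_cast
  nlinarith

theorem Supported.work_stageOne_le {s : Machine V} {S : Finset V} (h : s.Supported G)
    (hS : s.Represents G S) (hb : 0 < G.boundary S) (x : V) (D : List V) :
    ((s.stageOne G x D).work : ℝ) ≤ s.work + 32 * opBound G * G.boundary S := by
  have h1 := h.lookupCost_le hm
  have h2 : (s.bd.size : ℝ) ≤ 2 * G.boundary S := by exact_mod_cast hS.size_bd_le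
  have h3 := one_le_opBound G hm
  have h4 : (1 : ℝ) ≤ G.boundary S := by exact_mod_cast hb
  have h5 : (s.bd.size : ℝ) * (s.lookupCost + 4) ≤ 2 * G.boundary S * (10 * opBound G) :=
    mul_le_mul h2 (by linarith) (by positivity) (by positivity)
  change ((s.work + (6 + s.lookupCost + s.bd.size * (s.lookupCost + 4)) : ℕ) : ℝ) ≤ _
  push_cast
  nlinarith

end

end Machine

section

variable {V : Type*} [Fintype V] [LinearOrder V] (G : SimpleGraph V) [DecidableRel G.Adj]

theorem exists_eq_changes_of_mem_support {s : Machine V} {x : V} {D : List V}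
    (hD : D ∈ (chooseChanges G s x).support) : ∃ z, D = s.changes G z := by
  let _ : MeasurableSpace (List V) := ⊤
  rw [PMF.mem_support_iff] at hD
  unfold chooseChanges at hD
  rw [MeasureTheory.Measure.toPMF_apply, MeasureTheory.Measure.map_apply
    (measurable_changes G s _) (by trivial)] at hD
  obtain ⟨u, hu⟩ := MeasureTheory.nonempty_of_measure_ne_zero hD
  exact ⟨_, hu.symm⟩

theorem volume_symmDiff_le {S D : Finset V} :
    G.volume (symmDiff S D) ≤ G.volume S + G.volume D := by
  refine (G.volume_mono (show symmDiff S D ⊆ S ∪ D from symmDiff_le_sup)).trans ?_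
  unfold SimpleGraph.volume
  rw [← Finset.sum_union_inter]
  exact Nat.le_add_right _ _

theorem sum_map_degree_eq_volume {D : List V} (hD : D.Nodup) :
    (D.map fun y => G.degree y).sum = G.volume D.toFinset := by
  rw [SimpleGraph.volume, List.sum_toFinset _ hD]

/-- While the run continues, the number of steps is at most proportional to the cost of the sample
path. Each step of the evolving set process is paid for by the boundary edges, of which there is at
least one, and when the budget is exceeded only the last scan of the boundary is in excess. -/
theorem work_run_le (hm : 2 ≤ G.volume Finset.univ) {B : ℝ} {θ : EReal} (hθ : 0 < θ) (k : ℕ) :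
    ∀ (s : Machine V) (S : Finset V), s.Represents G S → s.Supported G →
      0 < G.boundary S → G.volume S ≤ s.cost → (s.cost : ℝ) ≤ B →
      (s.work : ℝ) ≤ 36 * opBound G * s.cost →
      ∀ r ∈ (run G B θ k s).support, (r.2 : ℝ) ≤ 68 * opBound G * B := by
  have hΛ := one_le_opBound G hm
  induction k with
  | zero =>
    intro s S _ _ _ _ hcB hw r hr
    simp only [run, PMF.support_pure, Set.mem_singleton_iff] at hr
    subst hr
    refine hw.trans ?_
    have : (0 : ℝ) ≤ s.cost := Nat.cast_nonneg _
    nlinarith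
  | succ k ih =>
    intro s S hS hsup hb hvol hcB hw r hr
    simp only [run, PMF.mem_support_bind_iff] at hr
    obtain ⟨x, -, D, hD, hr⟩ := hr
    obtain ⟨z, hz⟩ := exists_eq_changes_of_mem_support G hD
    have hnd : D.Nodup := hz ▸ Machine.changes_nodup s z
    have hdeg : ∀ y ∈ D, 0 < G.degree y := by
      intro y hy
      rw [hz] at hy
      have := (List.mem_filter.1 hy).1
      rw [Std.TreeMap.mem_keys, Std.TreeMap.mem_iff_contains] at this
      exact hsup.2 y this
    have hw1 := hsup.work_stageOne_le hm hS hb x D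
    have hbS : (G.boundary S : ℝ) ≤ s.cost := by
      exact_mod_cast (G.boundary_le_volume S).trans hvol
    have hb1 : (1 : ℝ) ≤ G.boundary S := by exact_mod_cast hb
    split_ifs at hr with h1 h2
    · simp only [PMF.support_pure, Set.mem_singleton_iff] at hr
      subst hr
      change ((s.stageOne G x D).work : ℝ) ≤ _
      nlinarith
    all_goals
      have hsup1 : (s.stageOne G x D).Supported G := hsup
      obtain ⟨hsup2, hw2⟩ := hsup1.foldl_toggle hm hdeg
      have hcost : ((s.stageOne G x D).stageTwo G D).cost
          = s.cost + ((D.map fun y => G.degree y).sum + s.bdry) :=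
        Machine.cost_stageTwo _ _
      have hcost' : (((s.stageOne G x D).stageTwo G D).cost : ℝ)
          = s.cost + ((D.map fun y => G.degree y).sum + G.boundary S) := by
        rw [hcost, hS.bdry]; push_cast; ring
      have hcB' : (((s.stageOne G x D).stageTwo G D).cost : ℝ) ≤ B := by
        rw [Machine.cost_stageTwo]; exact not_lt.1 h1
      have hw3 : (((s.stageOne G x D).stageTwo G D).work : ℝ) ≤
          36 * opBound G * ((s.stageOne G x D).stageTwo G D).cost := by
        change ((((D.foldl (fun s y => s.toggle G y) (s.stageOne G x D)).work + 4 : ℕ)) : ℝ) ≤ _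
        rw [hcost']
        push_cast at hw2 ⊢
        have hd0 : (0 : ℝ) ≤ (((D.map fun y => G.degree y).sum : ℕ) : ℝ) := Nat.cast_nonneg _
        push_cast at hd0
        nlinarith
    · simp only [PMF.support_pure, Set.mem_singleton_iff] at hr
      subst hr
      refine hw3.trans ?_
      have : (0 : ℝ) ≤ ((s.stageOne G x D).stageTwo G D).cost := Nat.cast_nonneg _
      change 36 * opBound G * (((s.stageOne G x D).stageTwo G D).cost : ℝ) ≤ _
      nlinarith
    · have hR : ((s.stageOne G x D).stageTwo G D).Represents G (symmDiff S D.toFinset) :=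
        (hS.stageOne x D).stageTwo hnd
      refine ih _ _ hR hsup2 ?_ ?_ hcB' hw3 r hr
      · rw [← hR.bdry]
        by_contra h0
        apply h2
        rw [Nat.eq_zero_of_not_pos h0]
        simpa using hθ
      · rw [hcost, sum_map_degree_eq_volume G hnd]
        have := volume_symmDiff_le G (S := S) (D := D.toFinset)
        omega

theorem work_generateSample_le (hm : 2 ≤ G.volume Finset.univ) {x : V} (hx : 0 < G.degree x)
    (T : ℕ) {B : ℝ} (hB : 0 ≤ B) :
    ∀ r ∈ (generateSample G x T B).support,
      (r.2 : ℝ) ≤ 6 + if T = 0 then 0 else 68 * opBound G * B := by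
  intro r hr
  have hΛ := one_le_opBound G hm
  unfold generateSample at hr
  split_ifs at hr with h1
  · simp only [PMF.support_pure, Set.mem_singleton_iff] at hr
    subst hr
    split_ifs <;> push_cast <;> nlinarith
  · push Not at h1
    obtain ⟨h1, h2, h3⟩ := h1
    rw [if_neg h2]
    obtain ⟨hs1, hs2⟩ := Machine.supported_init hm hx
    have := work_run_le G hm (theta_pos G hm T) T (Machine.init G x) {x}
      (Machine.represents_init x) hs1 ?_ ?_ ?_ ?_ r hr
    · linarith
    · by_contra h0
      refine absurd (theta_pos G hm T) (not_lt.2 (h1.trans ?_))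
      unfold SimpleGraph.conductance
      rw [Nat.eq_zero_of_not_pos h0]
      simp
    · rw [Machine.cost_init]; simp [SimpleGraph.volume]
    · rw [Machine.cost_init]; exact h3
    · rw [Machine.cost_init]; exact hs2

end
end EvoNibble

/-! ### Expectations over a probability mass function -/

namespace PMF

variable {α β : Type*}

/-- The expectation of a function with values in `[0, ∞]`. -/
noncomputable def expect (p : PMF α) (f : α → ℝ≥0∞) : ℝ≥0∞ := ∑' a, p a * f a

theorem expect_pure (a : α) (f : α → ℝ≥0∞) : (pure a).expect f = f a := by
  unfold expect
  rw [tsum_eq_single a]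
  · simp
  · intro b hb; simp [pure_apply, hb]

theorem expect_bind (p : PMF α) (q : α → PMF β) (f : β → ℝ≥0∞) :
    (p.bind q).expect f = p.expect fun a => (q a).expect f := by
  unfold expect
  simp only [bind_apply, ← ENNReal.tsum_mul_right, ← ENNReal.tsum_mul_left]
  rw [ENNReal.tsum_comm]
  simp only [mul_assoc]

theorem expect_mono (p : PMF α) {f g : α → ℝ≥0∞} (h : ∀ a ∈ p.support, f a ≤ g a) :
    p.expect f ≤ p.expect g := by
  refine ENNReal.tsum_le_tsum fun a => ?_
  by_cases ha : p a = 0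
  · simp [ha]
  · gcongr
    exact h a ((p.mem_support_iff a).2 ha)

theorem expect_const (p : PMF α) (c : ℝ≥0∞) : (p.expect fun _ => c) = c := by
  unfold expect
  rw [ENNReal.tsum_mul_right, p.tsum_coe, one_mul]

theorem expect_fintype [Fintype α] (p : PMF α) (f : α → ℝ≥0∞) :
    p.expect f = ∑ a, p a * f a := tsum_fintype _

theorem expect_map (p : PMF α) (g : α → β) (f : β → ℝ≥0∞) :
    (p.map g).expect f = p.expect (f ∘ g) := by
  unfold map
  rw [expect_bind]
  simp only [Function.comp_def, expect_pure]

end PMF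

namespace EvoNibble

/-! ### The parameters of the algorithm -/

theorem one_le_sum_two_inv_pow (N : ℕ) : 1 ≤ ∑' j : Fin (N + 1), (2⁻¹ : ℝ≥0∞) ^ (j : ℕ) := by
  refine le_trans ?_ (ENNReal.le_tsum 0)
  simp

theorem budgetIndex_le (N : ℕ) (j : Fin (N + 1)) : budgetIndex N j ≤ (2⁻¹ : ℝ≥0∞) ^ (j : ℕ) := by
  unfold budgetIndex
  rw [PMF.normalize_apply]
  refine mul_le_of_le_one_right (by simp) ?_
  exact ENNReal.inv_le_one.2 (one_le_sum_two_inv_pow N)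

theorem le_budgetIndex (N : ℕ) (j : Fin (N + 1)) :
    (2⁻¹ : ℝ≥0∞) ^ (j : ℕ) * 2⁻¹ ≤ budgetIndex N j := by
  unfold budgetIndex
  rw [PMF.normalize_apply]
  gcongr
  rw [tsum_fintype, Fin.sum_univ_eq_sum_range (fun j => (2⁻¹ : ℝ≥0∞) ^ j)]
  refine (ENNReal.sum_le_tsum _).trans ?_
  rw [ENNReal.tsum_geometric, ENNReal.one_sub_inv_two, inv_inv]

section

variable {V : Type*} [Fintype V] (G : SimpleGraph V) [DecidableRel G.Adj]

theorem theta_of_ne_zero {T : ℕ} (hT : T ≠ 0) : theta G T =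
    ((Real.sqrt (4 * (T : ℝ)⁻¹ * Real.log (G.volume Finset.univ)) : ℝ) : EReal) := if_neg hT

theorem timeLimit_bounds {φ : ℝ} (hφ : 0 < φ) (hT : timeLimit φ ≠ 0) :
    (timeLimit φ : ℝ) ≤ φ⁻¹ / 100 ∧ φ⁻¹ / 200 ≤ timeLimit φ := by
  have h1 : (timeLimit φ : ℝ) ≤ φ⁻¹ / 100 := Nat.floor_le (by positivity)
  have h2 : φ⁻¹ / 100 < timeLimit φ + 1 := Nat.lt_floor_add_one _
  have h3 : (1 : ℝ) ≤ timeLimit φ := by exact_mod_cast Nat.one_le_iff_ne_zero.2 hT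
  exact ⟨h1, by linarith⟩

theorem lt_of_timeLimit_eq_zero {φ : ℝ} (hφ : 0 < φ) (hT : timeLimit φ = 0) : 1 / 100 < φ := by
  have h2 : φ⁻¹ / 100 < timeLimit φ + 1 := Nat.lt_floor_add_one _
  rw [hT] at h2
  have h3 : φ⁻¹ < 100 := by simp at h2; linarith
  rw [inv_lt_comm₀ hφ (by norm_num)] at h3
  linarith

theorem maxIndex_le (hm : 2 ≤ G.volume Finset.univ) :
    (maxIndex G : ℝ) ≤ 4 * Real.log (G.volume Finset.univ) := by
  have h1 := half_lt_log_volume G hm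
  have h2 : (maxIndex G : ℝ) < Real.logb 2 (G.volume Finset.univ) + 1 :=
    Nat.ceil_lt_add_one (Real.logb_nonneg (by norm_num) (by exact_mod_cast (by omega)))
  have h3 : Real.logb 2 (G.volume Finset.univ) ≤ 2 * Real.log (G.volume Finset.univ) := by
    unfold Real.logb
    rw [div_le_iff₀ (Real.log_pos (by norm_num))]
    nlinarith [Real.log_two_gt_d9]
  linarith

theorem budget_nonneg (φ : ℝ) (j : ℕ) : 0 ≤ budget G φ j := by
  unfold budget
  positivity

theorem conductance_le_one [DecidableEq V] (S : Finset V) : G.conductance S ≤ 1 := by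
  unfold SimpleGraph.conductance
  exact div_le_one_of_le₀ (by exact_mod_cast G.boundary_le_volume S) (Nat.cast_nonneg _)

theorem conductance_nonneg [DecidableEq V] (S : Finset V) : 0 ≤ G.conductance S := by
  unfold SimpleGraph.conductance
  positivity

/-! ### The expected running time -/

theorem startVertex_apply (hG : 0 < G.volume Finset.univ) (x : V) :
    startVertex G hG x = G.degree x * (G.volume Finset.univ : ℝ≥0∞)⁻¹ := by
  unfold startVertex
  rw [PMF.normalize_apply, tsum_fintype, ← Nat.cast_sum]
  rfl

/-- An upper bound for the ratio between the number of steps of `GenerateSample` and `2 ^ J`. -/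
noncomputable def workScale (φ : ℝ) : ℝ :=
  if timeLimit φ = 0 then 0 else 68 * opBound G * budget G φ 0

theorem workScale_mul_two_pow (φ : ℝ) (j : ℕ) :
    workScale G φ * 2 ^ j = if timeLimit φ = 0 then 0 else 68 * opBound G * budget G φ j := by
  unfold workScale budget
  split_ifs <;> simp [mul_assoc]

theorem steps_le (hm : 2 ≤ G.volume Finset.univ) {φ : ℝ} (hφ : 0 < φ) (hφ1 : φ < 1) :
    23 + maxIndex G + (maxIndex G + 1) * workScale G φ ≤
      10 ^ 5 * (φ ^ (-(1 / 2) : ℝ) * Real.log (G.volume Finset.univ) ^ (5 / 2 : ℝ)) := by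
  have hN := maxIndex_le G hm
  have hL := half_lt_log_volume G hm
  set L := Real.log (G.volume Finset.univ) with hLdef
  have hL0 : 0 < L := by linarith
  have e1 : L ^ (5 / 2 : ℝ) = Real.sqrt L ^ 5 := by
    rw [Real.sqrt_eq_rpow, ← Real.rpow_natCast, ← Real.rpow_mul hL0.le]
    norm_num
  have e2 : φ ^ (-(1 / 2) : ℝ) = (Real.sqrt φ)⁻¹ := by
    rw [Real.rpow_neg hφ.le, ← Real.sqrt_eq_rpow]
  rw [e1, e2]
  set l := Real.sqrt L with hl
  set q := (Real.sqrt φ)⁻¹ with hq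
  have hlsq : l ^ 2 = L := Real.sq_sqrt hL0.le
  have hl1 : 1 / 2 ≤ l := by
    rw [hl]; apply Real.le_sqrt_of_sq_le; linarith
  have hq1 : 1 ≤ q := by
    rw [hq]
    refine (one_le_inv₀ (Real.sqrt_pos.2 hφ)).2 ?_
    exact (Real.sqrt_le_sqrt hφ1.le).trans (by simp)
  have hl3 : (1 / 8 : ℝ) ≤ l ^ 3 := by
    have := pow_le_pow_left₀ (by norm_num) hl1 3
    norm_num at this ⊢; exact this
  have hlq : 1 / 8 ≤ q * l ^ 3 := by nlinarith
  have hlq' : L ≤ 8 * (q * l ^ 5) := by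
    calc L = 8 * (l ^ 2 * (1 / 8)) := by rw [hlsq]; ring
      _ ≤ 8 * (l ^ 2 * (q * l ^ 3)) := by gcongr
      _ = _ := by ring
  have hw : workScale G φ ≤ 68 * (10 * L) * (8 * (3 * (q * l))) ∧ 0 ≤ workScale G φ := by
    have hop : opBound G = 10 * L := rfl
    unfold workScale
    split_ifs with hT
    · exact ⟨by positivity, le_rfl⟩
    · have hs : Real.sqrt (timeLimit φ * L) ≤ q * l / 10 := by
        rw [Real.sqrt_le_left (by positivity)]
        have h1 := (timeLimit_bounds hφ hT).1
        have h2 : (q * l / 10) ^ 2 = φ⁻¹ / 100 * L := by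
          rw [div_pow, mul_pow, hlsq, hq, inv_pow, Real.sq_sqrt hφ.le]; ring
        rw [h2]
        gcongr
      have hb : budget G φ 0 = 8 * (1 + 4 * Real.sqrt (timeLimit φ * L)) := by
        unfold budget; rw [pow_zero, mul_one]
      rw [hop, hb]
      refine ⟨?_, by positivity⟩
      have : 1 ≤ 2 * (q * l) := by nlinarith
      gcongr
      linarith
  calc 23 + (maxIndex G : ℝ) + (maxIndex G + 1) * workScale G φ
      ≤ 50 * L + (6 * L) * (68 * (10 * L) * (8 * (3 * (q * l)))) := by
        refine add_le_add (by linarith) (mul_le_mul (by linarith) hw.1 hw.2 (by positivity))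
    _ = 50 * L + 97920 * (q * l ^ 5) := by rw [← hlsq]; ring
    _ ≤ _ := by nlinarith

end

section

variable {V : Type*} [Fintype V] [LinearOrder V] (G : SimpleGraph V) [DecidableRel G.Adj]
  (hG : 0 < G.volume Finset.univ)

theorem expectedWork_le {φ : ℝ} (hφ : 0 < φ) (hφ1 : φ < 1) :
    expectedWork G hG φ ≤ ENNReal.ofReal
      (10 ^ 5 * (φ ^ (-(1 / 2) : ℝ) * Real.log (G.volume Finset.univ) ^ (5 / 2 : ℝ))) := by
  have hm := G.two_le_volume_univ hG
  refine le_trans ?_ (ENNReal.ofReal_le_ofReal (steps_le G hm hφ hφ1))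
  have hw0 : 0 ≤ workScale G φ := by
    have := one_le_opBound G hm
    have := budget_nonneg G φ 0
    unfold workScale
    split_ifs <;> positivity
  change (evoNibble G hG φ).expect (fun r => (r.2 : ℝ≥0∞)) ≤ _
  unfold evoNibble
  simp only [PMF.expect_bind, PMF.expect_pure]
  rw [← PMF.expect_const (startVertex G hG) (ENNReal.ofReal _)]
  refine PMF.expect_mono _ fun x hx => ?_
  have hx0 : 0 < G.degree x := by
    rw [PMF.mem_support_iff, startVertex_apply] at hx
    exact Nat.pos_of_ne_zero fun h => hx (by simp [h])
  have hj : ∀ j : Fin (maxIndex G + 1),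
      ((generateSample G x (timeLimit φ) (budget G φ j)).expect fun r =>
        ((r.2 + (maxIndex G + 1) + 16 : ℕ) : ℝ≥0∞)) ≤
      ENNReal.ofReal (23 + maxIndex G) + ENNReal.ofReal (workScale G φ * 2 ^ (j : ℕ)) := by
    intro j
    rw [← ENNReal.ofReal_add (by positivity) (by positivity),
      ← PMF.expect_const (generateSample G x (timeLimit φ) (budget G φ j)) (ENNReal.ofReal _)]
    refine PMF.expect_mono _ fun r hr => ?_
    rw [← ENNReal.ofReal_natCast]
    refine ENNReal.ofReal_le_ofReal ?_
    have := work_generateSample_le G hm hx0 _ (budget_nonneg G φ j) r hr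
    rw [← workScale_mul_two_pow] at this
    push_cast
    linarith
  refine (PMF.expect_mono _ fun j _ => hj j).trans ?_
  rw [PMF.expect_fintype]
  simp only [mul_add, Finset.sum_add_distrib]
  rw [← Finset.sum_mul, ← tsum_fintype (L := .unconditional _), PMF.tsum_coe, one_mul,
    ENNReal.ofReal_add (p := 23 + (maxIndex G : ℝ)) (by positivity) (by positivity)]
  refine add_le_add_right ?_ _
  calc ∑ j : Fin (maxIndex G + 1),
        budgetIndex (maxIndex G) j * ENNReal.ofReal (workScale G φ * 2 ^ (j : ℕ))
      ≤ ∑ _j : Fin (maxIndex G + 1), ENNReal.ofReal (workScale G φ) := by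
        refine Finset.sum_le_sum fun j _ => ?_
        refine (mul_le_mul_left (budgetIndex_le _ j) _).trans ?_
        rw [show (2⁻¹ : ℝ≥0∞) ^ (j : ℕ) = ENNReal.ofReal ((2⁻¹ : ℝ) ^ (j : ℕ)) by
          rw [ENNReal.ofReal_pow (by norm_num), ENNReal.ofReal_inv_of_pos (by norm_num)]; simp,
          ← ENNReal.ofReal_mul (by positivity)]
        refine ENNReal.ofReal_le_ofReal (le_of_eq ?_)
        rw [inv_pow]
        field_simp
    _ = ENNReal.ofReal ((maxIndex G + 1) * workScale G φ) := by
        rw [Finset.sum_const, Finset.card_univ, Fintype.card_fin, nsmul_eq_mul,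
          ENNReal.ofReal_mul (by positivity)]
        congr 1
        rw [← Nat.cast_add_one, ENNReal.ofReal_natCast]

/-! ### The guarantee for every possible output -/

theorem mem_support_output {φ : ℝ} {S : Finset V} (hS : S ∈ (output G hG φ).support) :
    S = ∅ ∨ ((G.conductance S : EReal) ≤ 3 * theta G (timeLimit φ) ∧
      (G.volume S : ℝ) ≤ 3 / 4 * G.volume Finset.univ) := by
  unfold output evoNibble at hS
  simp only [PMF.support_map, Set.mem_image, PMF.mem_support_bind_iff, PMF.support_pure,
    Set.mem_singleton_iff] at hS
  obtain ⟨r, ⟨x, -, j, -, r', -, rfl⟩, rfl⟩ := hS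
  dsimp only
  split_ifs with h
  · exact Or.inr h
  · exact Or.inl rfl

theorem conductance_le_of_le_theta {φ : ℝ} (hφ : 0 < φ) {S : Finset V}
    (hS : (G.conductance S : EReal) ≤ 3 * theta G (timeLimit φ)) (hm : 2 ≤ G.volume Finset.univ) :
    G.conductance S ≤ 10 ^ 5 * Real.sqrt (φ * Real.log (G.volume Finset.univ)) := by
  have hL := half_lt_log_volume G hm
  set L := Real.log (G.volume Finset.univ) with hLdef
  by_cases hT : timeLimit φ = 0
  · have h1 := lt_of_timeLimit_eq_zero hφ hT
    have h2 : (1 / 100 : ℝ) ≤ Real.sqrt (φ * L) := Real.le_sqrt_of_sq_le (by nlinarith)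
    have h3 := conductance_le_one G S
    linarith
  · rw [theta_of_ne_zero G hT, show (3 : EReal) = ((3 : ℝ) : EReal) from rfl, ← EReal.coe_mul,
      EReal.coe_le_coe_iff] at hS
    refine hS.trans ?_
    have h2 : (timeLimit φ : ℝ)⁻¹ ≤ 200 * φ := by
      refine inv_le_of_inv_le₀ (by positivity) ?_
      have := (timeLimit_bounds hφ hT).2
      rw [mul_inv]
      linarith
    have h3 : Real.sqrt (4 * (timeLimit φ : ℝ)⁻¹ * L) ≤ 30 * Real.sqrt (φ * L) := by
      rw [Real.sqrt_le_left (by positivity), mul_pow, Real.sq_sqrt (by positivity)]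
      nlinarith
    have := Real.sqrt_nonneg (φ * L)
    linarith

end
end EvoNibble

/-! ### One step of the evolving set process -/

namespace EvoNibble

open MeasureTheory Set in
theorem integral_Ioc_ite_le (a b p c : ℝ) :
    ∫ z in Ioc a b, (if z ≤ p then c else 0) = max (min b p - a) 0 * c := by
  have h1 : (fun z : ℝ => if z ≤ p then c else 0) = (Iic p).indicator fun _ => c := by
    ext z
    simp [indicator_apply]
  rw [h1, setIntegral_indicator measurableSet_Iic, setIntegral_const, Ioc_inter_Iic,
    Real.volume_real_Ioc, smul_eq_mul]

/-- The tangent of `v ↦ v (log v - log μ)` at `v = μ exp s`. -/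
theorem le_mul_log_sub_log {v μ : ℝ} (hv : 0 ≤ v) (hμ : 0 < μ) (s : ℝ) :
    (s + 1) * v - Real.exp s * μ ≤ v * (Real.log v - Real.log μ) := by
  rcases hv.eq_or_lt with rfl | hv
  · have := Real.exp_pos s
    nlinarith
  · have h1 := Real.log_le_sub_one_of_pos (show 0 < Real.exp s * μ / v by positivity)
    rw [Real.log_div (by positivity) (by positivity), Real.log_mul (by positivity) (by positivity),
      Real.log_exp] at h1
    have h2 : v * (s + Real.log μ - Real.log v) ≤ v * (Real.exp s * μ / v - 1) :=
      mul_le_mul_of_nonneg_left h1 hv.le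
    have h3 : v * (Real.exp s * μ / v - 1) = Real.exp s * μ - v := by field_simp
    linarith

theorem exp_add_exp_neg_le {x : ℝ} (h0 : 0 ≤ x) (h1 : x ≤ 1) :
    Real.exp x + Real.exp (-x) ≤ 2 + 6 / 5 * x ^ 2 := by
  have e1 := (abs_le.1 (Real.exp_bound (x := x) (by rw [abs_of_nonneg h0]; exact h1)
    (n := 4) (by norm_num))).2
  have e2 := (abs_le.1 (Real.exp_bound (x := -x) (by rw [abs_neg, abs_of_nonneg h0]; exact h1)
    (n := 4) (by norm_num))).2
  rw [abs_neg] at e2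
  rw [abs_of_nonneg h0] at e1 e2
  norm_num [Finset.sum_range_succ, Nat.factorial] at e1 e2
  have : x ^ 4 ≤ x ^ 2 := pow_le_pow_of_le_one h0 h1 (by norm_num)
  nlinarith

section

variable {V : Type*} [Fintype V] (G : SimpleGraph V) [DecidableRel G.Adj]

/-- One step of the lazy random walk, as an operator on functions. -/
noncomputable def lazyStep (h : V → ℝ) (y : V) : ℝ :=
  (h y + (∑ w ∈ G.neighborFinset y, h w) / G.degree y) / 2

theorem lazyStep_one_mul_degree (y : V) :
    (G.degree y : ℝ) * lazyStep G (fun _ => 1) y = G.degree y := by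
  unfold lazyStep
  rw [Finset.sum_const, SimpleGraph.card_neighborFinset_eq_degree, nsmul_eq_mul, mul_one]
  by_cases h0 : G.degree y = 0
  · simp [h0]
  · field_simp
    norm_num

theorem lazyStep_mono {f g : V → ℝ} (h : ∀ y, f y ≤ g y) (y : V) :
    lazyStep G f y ≤ lazyStep G g y := by
  unfold lazyStep
  have := Finset.sum_le_sum fun w (_ : w ∈ G.neighborFinset y) => h w
  have := h y
  gcongr

theorem lazyStep_one_le (y : V) : lazyStep G (fun _ => 1) y ≤ 1 := by
  unfold lazyStep
  rw [Finset.sum_const, SimpleGraph.card_neighborFinset_eq_degree, nsmul_eq_mul, mul_one]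
  have := div_self_le_one (G.degree y : ℝ)
  linarith

end

section

variable {V : Type*} [Fintype V] [DecidableEq V] (G : SimpleGraph V) [DecidableRel G.Adj]

/-- The probability `p(y, S)` that the lazy random walk moves from `y` into `S`. For an isolated
vertex the division by the degree makes this `1 / 2` or `0`; such vertices have no weight in the
identities below. -/
noncomputable def transTo (S : Finset V) (y : V) : ℝ :=
  ((G.edgesInto S y : ℝ) / (G.degree y : ℝ) + if y ∈ S then 1 else 0) / 2

/-- The set `{y | p(y, S) ≥ z}` that follows `S` in the evolving set process. -/
noncomputable def level (S : Finset V) (z : ℝ) : Finset V :=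
  Finset.univ.filter fun y => z ≤ transTo G S y

/-- The expectation of `h` after one step of the (unbiased) evolving set process from `S`. -/
noncomputable def evolve (S : Finset V) (h : Finset V → ℝ) : ℝ :=
  ∫ z in Set.Ioc (0 : ℝ) 1, h (level G S z)

theorem mem_level {S : Finset V} {z : ℝ} {y : V} : y ∈ level G S z ↔ z ≤ transTo G S y := by
  simp [level]

theorem transTo_nonneg (S : Finset V) (y : V) : 0 ≤ transTo G S y := by
  unfold transTo
  positivity

theorem edgesInto_div_degree_le_one (S : Finset V) (y : V) :
    (G.edgesInto S y : ℝ) / G.degree y ≤ 1 :=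
  div_le_one_of_le₀ (by exact_mod_cast G.edgesInto_le_degree S y) (Nat.cast_nonneg _)

theorem transTo_le_one (S : Finset V) (y : V) : transTo G S y ≤ 1 := by
  have := edgesInto_div_degree_le_one G S y
  unfold transTo
  split_ifs <;> linarith

theorem half_le_transTo {S : Finset V} {y : V} (hy : y ∈ S) : 1 / 2 ≤ transTo G S y := by
  unfold transTo
  rw [if_pos hy]
  have : (0 : ℝ) ≤ (G.edgesInto S y : ℝ) / G.degree y := by positivity
  linarith

theorem transTo_le_half {S : Finset V} {y : V} (hy : y ∉ S) : transTo G S y ≤ 1 / 2 := by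
  have := edgesInto_div_degree_le_one G S y
  unfold transTo
  rw [if_neg hy]
  linarith

theorem degree_mul_transTo (S : Finset V) (y : V) : (G.degree y : ℝ) * transTo G S y =
    (G.edgesInto S y + if y ∈ S then (G.degree y : ℝ) else 0) / 2 := by
  have h : (G.degree y : ℝ) * ((G.edgesInto S y : ℝ) / G.degree y) = G.edgesInto S y := by
    by_cases h0 : G.degree y = 0
    · have := G.edgesInto_le_degree S y
      rw [show G.edgesInto S y = 0 by omega, h0]; simp
    · field_simp
  unfold transTo
  split_ifs <;> linarith

/-- The lazy random walk is reversible with respect to the degrees. -/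
theorem sum_degree_mul_lazyStep (S : Finset V) (h : V → ℝ) :
    ∑ y ∈ S, (G.degree y : ℝ) * lazyStep G h y = ∑ y, transTo G S y * (G.degree y * h y) := by
  have h1 : ∀ y, (G.degree y : ℝ) * lazyStep G h y =
      (G.degree y * h y + ∑ w ∈ G.neighborFinset y, h w) / 2 := by
    intro y
    unfold lazyStep
    by_cases h0 : G.degree y = 0
    · have : G.neighborFinset y = ∅ := by
        rw [← Finset.card_eq_zero, SimpleGraph.card_neighborFinset_eq_degree, h0]
      rw [this, h0]; simp
    · field_simp
  simp only [h1]
  rw [← Finset.sum_div, Finset.sum_add_distrib, G.sum_sum_neighborFinset]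
  have h2 : ∑ y ∈ S, (G.degree y : ℝ) * h y = ∑ y, if y ∈ S then (G.degree y : ℝ) * h y else 0 := by
    simp
  rw [h2, ← Finset.sum_add_distrib, Finset.sum_div]
  refine Finset.sum_congr rfl fun y _ => ?_
  have := degree_mul_transTo G S y
  calc ((if y ∈ S then (G.degree y : ℝ) * h y else 0) + G.edgesInto S y • h y) / 2
      = ((G.edgesInto S y + if y ∈ S then (G.degree y : ℝ) else 0) / 2) * h y := by
        rw [nsmul_eq_mul]; split_ifs <;> ring
    _ = _ := by rw [← this]; ring

open MeasureTheory Set in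
theorem measurable_level {β : Type*} [MeasurableSpace β] (S : Finset V) (h : Finset V → β) :
    Measurable fun z => h (level G S z) := by
  let _ : MeasurableSpace (Finset V) := ⊤
  refine (measurable_from_top (f := h)).comp (measurable_to_countable' fun A => ?_)
  have : (fun z => level G S z) ⁻¹' {A} =
      ⋂ y, {z : ℝ | z ≤ transTo G S y ↔ y ∈ A} := by
    ext z
    simp [Finset.ext_iff, mem_level]
  rw [this]
  refine MeasurableSet.iInter fun y => ?_
  by_cases hy : y ∈ A
  · simp only [hy, iff_true]
    exact measurableSet_Iic
  · simp only [hy, iff_false, not_le]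
    exact measurableSet_Ioi

open MeasureTheory Set in
theorem integrable_level (S : Finset V) (h : Finset V → ℝ) (a b : ℝ) :
    Integrable (fun z => h (level G S z)) (volume.restrict (Ioc a b)) := by
  obtain ⟨C, hC⟩ := (Set.finite_range fun A => ‖h A‖).bddAbove
  exact Integrable.of_bound (measurable_level G S h).aestronglyMeasurable C
    (Filter.Eventually.of_forall fun z => hC ⟨_, rfl⟩)

theorem evolve_add (S : Finset V) (f g : Finset V → ℝ) :
    evolve G S (fun R => f R + g R) = evolve G S f + evolve G S g :=
  MeasureTheory.integral_add (integrable_level G S f 0 1) (integrable_level G S g 0 1)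

theorem evolve_sub (S : Finset V) (f g : Finset V → ℝ) :
    evolve G S (fun R => f R - g R) = evolve G S f - evolve G S g :=
  MeasureTheory.integral_sub (integrable_level G S f 0 1) (integrable_level G S g 0 1)

theorem evolve_const_mul (S : Finset V) (c : ℝ) (f : Finset V → ℝ) :
    evolve G S (fun R => c * f R) = c * evolve G S f :=
  MeasureTheory.integral_const_mul c _

theorem evolve_const (S : Finset V) (c : ℝ) : evolve G S (fun _ => c) = c := by
  simp [evolve]

open MeasureTheory Set in
theorem integral_sum_level (S : Finset V) (h : V → ℝ) (a b : ℝ) :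
    ∫ z in Ioc a b, ∑ y ∈ level G S z, h y = ∑ y, max (min b (transTo G S y) - a) 0 * h y := by
  simp only [level, Finset.sum_filter]
  rw [integral_finsetSum]
  · simp only [integral_Ioc_ite_le]
  · intro y _
    have h1 : (fun z : ℝ => if z ≤ transTo G S y then h y else 0)
        = (Iic (transTo G S y)).indicator fun _ => h y := by
      ext z
      simp [indicator_apply]
    rw [h1]
    exact (integrable_const _).indicator measurableSet_Iic

theorem evolve_sum (S : Finset V) (h : V → ℝ) :
    evolve G S (fun R => ∑ y ∈ R, h y) = ∑ y, transTo G S y * h y := by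
  refine (integral_sum_level G S h 0 1).trans (Finset.sum_congr rfl fun y _ => ?_)
  rw [min_eq_right (transTo_le_one G S y), sub_zero, max_eq_left (transTo_nonneg G S y)]

/-- The average over `S` of a function of the walk position, after one step of the walk. -/
theorem evolve_sum_degree_mul (S : Finset V) (h : V → ℝ) :
    evolve G S (fun R => ∑ y ∈ R, (G.degree y : ℝ) * h y) =
      ∑ y ∈ S, (G.degree y : ℝ) * lazyStep G h y := by
  rw [evolve_sum, sum_degree_mul_lazyStep]

/-- The volume is a martingale of the evolving set process. -/
theorem evolve_volume (S : Finset V) : evolve G S (fun R => (G.volume R : ℝ)) = G.volume S := by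
  have := evolve_sum_degree_mul G S fun _ => 1
  simp only [lazyStep_one_mul_degree, mul_one] at this
  simpa [SimpleGraph.volume] using this

theorem sum_edgesInto_eq_volume (S : Finset V) :
    ∑ y, (G.edgesInto S y : ℝ) = G.volume S := by
  have h1 := G.boundary_add_sum_edgesInto S
  rw [G.boundary_eq_sum_compl, add_comm, Finset.sum_add_sum_compl] at h1
  exact_mod_cast h1

theorem evolve_volume_symmDiff (S : Finset V) :
    evolve G S (fun R => (G.volume (symmDiff S R) : ℝ)) = G.boundary S := by
  have h1 : ∀ R : Finset V, (G.volume (symmDiff S R) : ℝ) =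
      G.volume S + ∑ y ∈ R, (if y ∈ S then -(G.degree y : ℝ) else G.degree y) := by
    intro R
    unfold SimpleGraph.volume
    push_cast
    rw [← Finset.sum_ite_mem_eq (symmDiff S R), ← Finset.sum_ite_mem_eq S,
      ← Finset.sum_ite_mem_eq R, ← Finset.sum_add_distrib]
    refine Finset.sum_congr rfl fun y _ => ?_
    by_cases hS : y ∈ S <;> by_cases hR : y ∈ R <;> simp [Finset.mem_symmDiff, hS, hR]
  simp only [h1]
  rw [evolve_add, evolve_const, evolve_sum]
  have h2 : ∀ y, transTo G S y * (if y ∈ S then -(G.degree y : ℝ) else G.degree y) =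
      (G.edgesInto S y : ℝ) / 2 - if y ∈ S then (G.edgesInto S y + G.degree y / 2 : ℝ) else 0 := by
    intro y
    have := degree_mul_transTo G S y
    split_ifs at this ⊢ <;> linarith
  simp only [h2]
  rw [Finset.sum_sub_distrib, ← Finset.sum_div, sum_edgesInto_eq_volume,
    Finset.sum_ite_mem_eq, Finset.sum_add_distrib, ← Finset.sum_div]
  have h3 : (G.boundary S : ℝ) + ∑ y ∈ S, (G.edgesInto S y : ℝ) = G.volume S := by
    exact_mod_cast G.boundary_add_sum_edgesInto S
  have h4 : ∑ y ∈ S, (G.degree y : ℝ) = G.volume S := by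
    unfold SimpleGraph.volume; push_cast; rfl
  rw [h4]
  linarith

open MeasureTheory Set in
/-- The thresholds below `1/2` make the set grow by the factor `1 + φ(S)` on average. -/
theorem integral_volume_level_lower (S : Finset V) :
    ∫ z in Ioc (0 : ℝ) (1 / 2), (G.volume (level G S z) : ℝ) =
      (G.volume S + G.boundary S) / 2 := by
  have h0 : ∀ R : Finset V, (G.volume R : ℝ) = ∑ y ∈ R, (G.degree y : ℝ) := by
    intro R; unfold SimpleGraph.volume; push_cast; rfl
  simp only [h0 (level G S _)]
  rw [integral_sum_level]
  have h1 : ∀ y, max (min (1 / 2) (transTo G S y) - 0) 0 * (G.degree y : ℝ) =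
      if y ∈ S then (G.degree y : ℝ) / 2 else (G.edgesInto S y : ℝ) / 2 := by
    intro y
    have h2 := degree_mul_transTo G S y
    have h3 := transTo_nonneg G S y
    split_ifs at h2 ⊢ with h
    · rw [min_eq_left (half_le_transTo G h), sub_zero, max_eq_left (by norm_num)]; ring
    · rw [min_eq_right (transTo_le_half G h), sub_zero, max_eq_left h3]; linarith
  simp only [h1]
  rw [Finset.sum_ite, ← Finset.sum_div, ← Finset.sum_div, h0, G.boundary_eq_sum_compl]
  push_cast
  rw [show Finset.univ.filter (fun y => y ∈ S) = S by ext; simp,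
    show Finset.univ.filter (fun y => ¬ y ∈ S) = Sᶜ by ext; simp]
  ring

open MeasureTheory Set in
theorem evolve_eq_add (S : Finset V) (h : Finset V → ℝ) : evolve G S h =
    (∫ z in Ioc (0 : ℝ) (1 / 2), h (level G S z)) + ∫ z in Ioc (1 / 2 : ℝ) 1, h (level G S z) := by
  unfold evolve
  rw [← Ioc_union_Ioc_eq_Ioc (a := (0 : ℝ)) (b := 1 / 2) (c := 1) (by norm_num) (by norm_num)]
  exact setIntegral_union (Ioc_disjoint_Ioc_of_le le_rfl) measurableSet_Ioc
    (integrable_level G S h _ _) (integrable_level G S h _ _)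

open MeasureTheory Set in
/-- In the volume-biased evolving set process the logarithm of the volume has a drift of order
`φ(S) ^ 2`. The two halves of the range of the threshold contribute the volumes
`(1 ± φ(S)) μ(S)` on average, and the convex function `v ↦ v log v` is compared with one of its
tangents on each half. -/
theorem le_evolve_volume_mul_log {S : Finset V} (hS : 0 < G.volume S) :
    2 / 5 * G.conductance S ^ 2 * G.volume S ≤ evolve G S (fun R =>
      (G.volume R : ℝ) * (Real.log (G.volume R) - Real.log (G.volume S))) := by
  have hμ : (0 : ℝ) < G.volume S := by exact_mod_cast hS
  set μ : ℝ := (G.volume S : ℝ) with hμdef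
  set c := G.conductance S with hc
  have hb : (G.boundary S : ℝ) = c * μ := by
    rw [hc, SimpleGraph.conductance, ← hμdef, div_mul_cancel₀ _ hμ.ne']
  have hlow := integral_volume_level_lower G S
  have htot := evolve_eq_add G S fun R => (G.volume R : ℝ)
  rw [evolve_volume, hlow] at htot
  have key : ∀ (s a b : ℝ), (s + 1) * (∫ z in Ioc a b, (G.volume (level G S z) : ℝ)) -
      Real.exp s * μ * volume.real (Ioc a b) ≤ ∫ z in Ioc a b, (G.volume (level G S z) : ℝ) *
        (Real.log (G.volume (level G S z)) - Real.log μ) := by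
    intro s a b
    have h1 := integrable_level G S (fun R => (G.volume R : ℝ)) a b
    have h2 := integrable_level G S (fun R => (G.volume R : ℝ) *
      (Real.log (G.volume R) - Real.log μ)) a b
    have h3 : Integrable (fun _ : ℝ => Real.exp s * μ) (volume.restrict (Ioc a b)) :=
      integrable_const _
    calc (s + 1) * (∫ z in Ioc a b, (G.volume (level G S z) : ℝ)) -
          Real.exp s * μ * volume.real (Ioc a b)
        = ∫ z in Ioc a b, ((s + 1) * (G.volume (level G S z) : ℝ) - Real.exp s * μ) := by
          rw [integral_sub (h1.const_mul _) h3, integral_const_mul, setIntegral_const, smul_eq_mul,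
            mul_comm (volume.real _)]
      _ ≤ _ := integral_mono ((h1.const_mul _).sub h3) h2 fun z =>
          le_mul_log_sub_log (Nat.cast_nonneg _) hμ s
  -- tangents at `μ exp (± φ(S))` rather than at `μ (1 ± φ(S))` avoid the vertical tangent at `0`
  have k1 := key c 0 (1 / 2)
  have k2 := key (-c) (1 / 2) 1
  rw [Real.volume_real_Ioc_of_le (by norm_num)] at k1 k2
  rw [evolve_eq_add]
  rw [hlow] at k1
  have hexp := exp_add_exp_neg_le (conductance_nonneg G S) (conductance_le_one G S)
  rw [← hc] at hexp
  have hexp' := mul_le_mul_of_nonneg_right hexp hμ.le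
  rw [hb] at k1 htot
  have hup : ∫ z in Ioc (1 / 2 : ℝ) 1, (G.volume (level G S z) : ℝ) = (μ - c * μ) / 2 := by
    linarith
  rw [hup] at k2
  nlinarith

/-! ### Escape probabilities -/

/-- The probability that the lazy random walk from a given vertex visits the complement of `A`
within `k` steps. -/
noncomputable def escape (A : Finset V) : ℕ → V → ℝ
  | 0, x => if x ∈ A then 0 else 1
  | k + 1, x => if x ∈ A then lazyStep G (escape A k) x else 1

theorem escape_nonneg (A : Finset V) (k : ℕ) (y : V) : 0 ≤ escape G A k y := by
  induction k generalizing y with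
  | zero => unfold escape; split_ifs <;> norm_num
  | succ k ih =>
    unfold escape
    split_ifs
    · have := lazyStep_mono G (f := fun _ => 0) ih y
      simpa [lazyStep] using this
    · norm_num

theorem escape_le_one (A : Finset V) (k : ℕ) (y : V) : escape G A k y ≤ 1 := by
  induction k generalizing y with
  | zero => unfold escape; split_ifs <;> norm_num
  | succ k ih =>
    unfold escape
    split_ifs
    · exact (lazyStep_mono G ih y).trans (lazyStep_one_le G y)
    · exact le_rfl

theorem escape_of_notMem {A : Finset V} {y : V} (hy : y ∉ A) (k : ℕ) : escape G A k y = 1 := by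
  cases k <;> simp [escape, hy]

theorem lazyStep_escape_le (A : Finset V) (k : ℕ) (y : V) :
    lazyStep G (escape G A k) y ≤ escape G A (k + 1) y := by
  rw [escape]
  split_ifs
  · exact le_rfl
  · exact (lazyStep_mono G (escape_le_one G A k) y).trans (lazyStep_one_le G y)

/-- In each step the stationary walk crosses the boundary of `A` outwards with probability
`∂(A) / (2 μ(V))`. -/
theorem sum_degree_mul_escape_le (A : Finset V) (k : ℕ) :
    ∑ y ∈ A, (G.degree y : ℝ) * escape G A k y ≤ k * (G.boundary A / 2) := by
  induction k with
  | zero =>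
    simp only [Nat.cast_zero, zero_mul]
    exact (Finset.sum_eq_zero fun y hy => by simp [escape, hy]).le
  | succ k ih =>
    have h1 : ∑ y ∈ A, (G.degree y : ℝ) * escape G A (k + 1) y =
        ∑ y ∈ A, (G.degree y : ℝ) * lazyStep G (escape G A k) y :=
      Finset.sum_congr rfl fun y hy => by simp [escape, hy]
    rw [h1, sum_degree_mul_lazyStep, ← Finset.sum_add_sum_compl A]
    have h2 : ∑ y ∈ A, transTo G A y * ((G.degree y : ℝ) * escape G A k y) ≤
        ∑ y ∈ A, (G.degree y : ℝ) * escape G A k y := by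
      refine Finset.sum_le_sum fun y _ => mul_le_of_le_one_left ?_ (transTo_le_one G A y)
      exact mul_nonneg (Nat.cast_nonneg _) (escape_nonneg G A k y)
    have h3 : ∑ y ∈ Aᶜ, transTo G A y * ((G.degree y : ℝ) * escape G A k y) =
        G.boundary A / 2 := by
      rw [G.boundary_eq_sum_compl]
      push_cast
      rw [Finset.sum_div]
      refine Finset.sum_congr rfl fun y hy => ?_
      have hy' : y ∉ A := by simpa using hy
      have := degree_mul_transTo G A y
      rw [if_neg hy', add_zero] at this
      rw [escape_of_notMem G hy']
      linarith
    rw [h3]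
    push_cast
    linarith

end

end EvoNibble

/-! ### The potential function -/

namespace EvoNibble

section

variable {V : Type*} [Fintype V] (G : SimpleGraph V) [DecidableRel G.Adj]

/-- The factor `γ = 1 + 4 √(T log μ(V))` by which the expected cost of a sample path may exceed the
volume of its last set. -/
noncomputable def costScale (T : ℕ) : ℝ :=
  1 + 4 * Real.sqrt (T * Real.log (G.volume Finset.univ))

theorem costScale_pos (T : ℕ) : 0 < costScale G T := by
  unfold costScale
  positivity

theorem budget_eq (φ : ℝ) (j : ℕ) :
    budget G φ j = 8 * costScale G (timeLimit φ) * 2 ^ j := rfl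

variable {G} in
theorem volume_univ_le_two_pow (hm : 2 ≤ G.volume Finset.univ) :
    (G.volume Finset.univ : ℝ) ≤ 2 ^ maxIndex G := by
  have h0 : (0 : ℝ) < G.volume Finset.univ := by exact_mod_cast (by omega)
  rw [← Real.rpow_natCast, ← Real.logb_le_iff_le_rpow (by norm_num) h0]
  exact Nat.le_ceil _

variable {G} in
/-- The random budget reaches the cost `c` with probability at least of the order of `γ / c`. -/
theorem le_volume_mul_sum_budgetIndex (hm : 2 ≤ G.volume Finset.univ) (φ : ℝ) {S : Finset V}
    (hS : 0 < G.volume S) {c : ℝ} (hc : 0 ≤ c) :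
    ENNReal.ofReal (1 - c / (8 * costScale G (timeLimit φ) * G.volume S)) ≤
      G.volume S * ∑ j : Fin (maxIndex G + 1),
        if c ≤ budget G φ j then budgetIndex (maxIndex G) j else 0 := by
  have hγ := costScale_pos G (timeLimit φ)
  set γ := costScale G (timeLimit φ) with hγdef
  have hμ1 : (1 : ℝ) ≤ G.volume S := by exact_mod_cast hS
  have hμm : (G.volume S : ℝ) ≤ G.volume Finset.univ := by
    exact_mod_cast G.volume_mono (Finset.subset_univ S)
  obtain ⟨v, rfl⟩ : ∃ v, c = 8 * γ * v := ⟨c / (8 * γ), by field_simp⟩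
  have hv0 : 0 ≤ v := by
    by_contra h
    nlinarith
  rw [mul_div_mul_left _ _ (by positivity)]
  have hiff : ∀ j : ℕ, 8 * γ * v ≤ budget G φ j ↔ v ≤ 2 ^ j := by
    intro j
    rw [budget_eq, mul_le_mul_iff_right₀ (by positivity)]
  simp only [hiff]
  rcases le_or_gt v 1 with h1 | h1
  · have hall : ∀ j : Fin (maxIndex G + 1), v ≤ 2 ^ (j : ℕ) := fun j =>
      h1.trans (one_le_pow₀ (by norm_num))
    simp only [hall, if_true]
    rw [← tsum_fintype (L := .unconditional _), PMF.tsum_coe, mul_one, ← ENNReal.ofReal_natCast]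
    refine ENNReal.ofReal_le_ofReal ?_
    have : 0 ≤ v / G.volume S := by positivity
    linarith
  rcases le_or_gt (G.volume S : ℝ) v with h2 | h2
  · rw [ENNReal.ofReal_of_nonpos]
    · exact zero_le
    · have := (one_le_div (by linarith)).2 h2
      linarith
  have hex : ∃ n : ℕ, v ≤ 2 ^ n :=
    ⟨maxIndex G, (h2.le.trans hμm).trans (volume_univ_le_two_pow hm)⟩
  set n := Nat.find hex with hn
  have hn1 : v ≤ 2 ^ n := Nat.find_spec hex
  have hnN : n ≤ maxIndex G :=
    Nat.find_min' hex ((h2.le.trans hμm).trans (volume_univ_le_two_pow hm))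
  have hn0 : n ≠ 0 := fun h => by
    rw [h] at hn1
    linarith [pow_zero (2 : ℝ)]
  have hn2 : (2 : ℝ) ^ n < 2 * v := by
    have h3 : ¬ v ≤ 2 ^ (n - 1) := Nat.find_min hex (by omega)
    have h4 : (2 : ℝ) ^ n = 2 * 2 ^ (n - 1) := by
      rw [← pow_succ']
      congr 1
      omega
    rw [h4]
    linarith [not_le.1 h3]
  have hle : budgetIndex (maxIndex G) ⟨n, by omega⟩ ≤ ∑ j : Fin (maxIndex G + 1),
      if v ≤ 2 ^ (j : ℕ) then budgetIndex (maxIndex G) j else 0 := by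
    refine le_trans ?_ (Finset.single_le_sum (fun _ _ => zero_le) (Finset.mem_univ ⟨n, by omega⟩))
    simp only [hn1, if_true, le_refl]
  refine le_trans ?_ (mul_le_mul_right ((le_budgetIndex _ _).trans hle) _)
  rw [show (2⁻¹ : ℝ≥0∞) ^ n * 2⁻¹ = ENNReal.ofReal ((2⁻¹ : ℝ) ^ n * 2⁻¹) by
      rw [ENNReal.ofReal_mul (by positivity), ENNReal.ofReal_pow (by norm_num),
        ENNReal.ofReal_inv_of_pos (by norm_num)]
      simp, ← ENNReal.ofReal_natCast, ← ENNReal.ofReal_mul (by positivity)]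
  refine ENNReal.ofReal_le_ofReal ?_
  have hμ : (0 : ℝ) < G.volume S := by linarith
  have h5 : (G.volume S : ℝ) * ((2 * v)⁻¹ * 2⁻¹) ≤ G.volume S * ((2⁻¹ : ℝ) ^ n * 2⁻¹) := by
    rw [inv_pow]
    gcongr
  refine le_trans ?_ h5
  -- `1 / (4 t) + t ≥ 1` for `t = v / μ(S)`
  have h6 : (G.volume S : ℝ) * ((2 * v)⁻¹ * 2⁻¹) - (1 - v / G.volume S) =
      (2 * v - G.volume S) ^ 2 / (4 * v * G.volume S) := by
    field_simp
    ring
  have h7 : 0 ≤ (2 * v - G.volume S) ^ 2 / (4 * v * (G.volume S : ℝ)) := by positivity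
  linarith

end

section

variable {V : Type*} [Fintype V] [LinearOrder V] (G : SimpleGraph V) [DecidableRel G.Adj]

/-- The potential of a sample path of the evolving set process with current set `S`, cost `c` and
`k` of `T` steps left, multiplied by `μ(S)`. The terms subtracted from `μ(S)` bound the
probabilities of the three reasons for a bad output: most of the set lies outside `A`, the cost is
large in comparison with the volume, and no set of small conductance is found. The last two grow
with the sum of `φ(S_t) ^ 2` over the path, which is controlled by the growth of `log μ(S_t)`. -/
noncomputable def potential (A : Finset V) (T k : ℕ) (S : Finset V) (c : ℝ) : ℝ :=
  G.volume S - 10 * ∑ y ∈ S, (G.degree y : ℝ) * escape G A k y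
    - (c + 5 / 2 * Real.sqrt (T / Real.log (G.volume Finset.univ)) *
          (G.volume S * (Real.log (G.volume Finset.univ) - Real.log (G.volume S)))
        + G.volume S * (k / Real.sqrt (T / Real.log (G.volume Finset.univ))))
      / (8 * costScale G T)
    - 5 / 8 / Real.log (G.volume Finset.univ) *
        (G.volume S * (Real.log (G.volume Finset.univ) - Real.log (G.volume S)))
    - G.volume S * ((T - k) / T)

variable {G}

/-- As long as the conductance is at least `√(4 log μ(V) / T)`, the potential is a submartingale of
the volume-biased evolving set process. -/
theorem potential_succ_le (hm : 2 ≤ G.volume Finset.univ) (A : Finset V) {T : ℕ} (hT : T ≠ 0)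
    (k : ℕ) {S : Finset V} (hS : 0 < G.volume S)
    (hφ : 4 * (T : ℝ)⁻¹ * Real.log (G.volume Finset.univ) ≤ G.conductance S ^ 2) (c : ℝ) :
    potential G A T (k + 1) S c ≤ evolve G S fun R =>
      potential G A T k R (c + G.volume (symmDiff S R) + G.boundary S) := by
  have hL : 0 < Real.log (G.volume Finset.univ) := by linarith [half_lt_log_volume G hm]
  have hT0 : (0 : ℝ) < T := by exact_mod_cast Nat.pos_of_ne_zero hT
  have hμ : (0 : ℝ) < G.volume S := by exact_mod_cast hS
  have hlam : 0 < Real.sqrt (T / Real.log (G.volume Finset.univ)) := Real.sqrt_pos.2 (by positivity)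
  have hg : 0 < (8 * costScale G T)⁻¹ := by have := costScale_pos G T; positivity
  have hdrift := le_evolve_volume_mul_log G hS
  have hesc : ∑ y ∈ S, (G.degree y : ℝ) * lazyStep G (escape G A k) y ≤
      ∑ y ∈ S, (G.degree y : ℝ) * escape G A (k + 1) y :=
    Finset.sum_le_sum fun y _ => mul_le_mul_of_nonneg_left (lazyStep_escape_le G A k y)
      (Nat.cast_nonneg _)
  have hb : (G.boundary S : ℝ) = G.conductance S * G.volume S := by
    rw [SimpleGraph.conductance, div_mul_cancel₀ _ hμ.ne']
  unfold potential
  simp only [div_eq_mul_inv _ (8 * costScale G T)]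
  set L := Real.log (G.volume Finset.univ) with hLdef
  set lam := Real.sqrt (T / L) with hlamdef
  set g := (8 * costScale G T)⁻¹ with hgdef
  set μ : ℝ := (G.volume S : ℝ) with hμdef
  set dr := evolve G S (fun R => (G.volume R : ℝ) * (Real.log (G.volume R) - Real.log μ)) with hdr
  set φ := G.conductance S with hφdef
  have hlin : (fun R : Finset V => (G.volume R : ℝ)
      - 10 * ∑ y ∈ R, (G.degree y : ℝ) * escape G A k y
      - (c + G.volume (symmDiff S R) + G.boundary S
          + 5 / 2 * lam * (G.volume R * (L - Real.log (G.volume R))) + G.volume R * (k / lam)) * g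
      - 5 / 8 / L * (G.volume R * (L - Real.log (G.volume R))) - G.volume R * ((T - k) / T)) =
      fun R => (1 - g * (k / lam) - (T - k) / T - (g * (5 / 2 * lam) + 5 / 8 / L) *
          (L - Real.log μ)) * (G.volume R : ℝ)
        - 10 * ∑ y ∈ R, (G.degree y : ℝ) * escape G A k y
        - g * (G.volume (symmDiff S R) : ℝ)
        + (g * (5 / 2 * lam) + 5 / 8 / L) *
          ((G.volume R : ℝ) * (Real.log (G.volume R) - Real.log μ))
        - g * (c + G.boundary S) := by
    funext R
    ring
  rw [hlin, evolve_sub, evolve_add, evolve_sub, evolve_sub, evolve_const_mul, evolve_const_mul,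
    evolve_const_mul, evolve_const_mul, evolve_const, evolve_volume, evolve_sum_degree_mul,
    evolve_volume_symmDiff, ← hdr, ← hμdef, hb]
  -- `2 φ(S) ≤ lam φ(S) ^ 2 + 1 / lam`, so the drift of the logarithm pays for the cost of the step
  have h1 : 0 ≤ g * (5 / 2 * lam * dr - 2 * (φ * μ) + μ / lam) := by
    refine mul_nonneg hg.le ?_
    have h2 : 5 / 2 * lam * (2 / 5 * φ ^ 2 * μ) ≤ 5 / 2 * lam * dr :=
      mul_le_mul_of_nonneg_left hdrift (by positivity)
    have h3 : 0 ≤ (lam * φ - 1) ^ 2 * μ / lam := by positivity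
    have h4 : (lam * φ - 1) ^ 2 * μ / lam =
        5 / 2 * lam * (2 / 5 * φ ^ 2 * μ) - 2 * (φ * μ) + μ / lam := by
      field_simp
      ring
    linarith
  have h5 : μ / T ≤ 5 / 8 / L * dr := by
    have h6 : 5 / 8 / L * (2 / 5 * φ ^ 2 * μ) ≤ 5 / 8 / L * dr :=
      mul_le_mul_of_nonneg_left hdrift (by positivity)
    refine le_trans ?_ h6
    have h7 : 5 / 8 / L * (2 / 5 * (4 * (T : ℝ)⁻¹ * L) * μ) ≤ 5 / 8 / L * (2 / 5 * φ ^ 2 * μ) := by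
      gcongr
    refine le_trans (le_of_eq ?_) h7
    field_simp
    norm_num
  have h8 : μ * (((T : ℝ) - (k + 1 : ℕ)) / T) = μ * ((T - k) / T) - μ / T := by
    push_cast
    field_simp
    ring
  have h9 : μ * (((k + 1 : ℕ) : ℝ) / lam) = μ * (k / lam) + μ / lam := by
    push_cast
    field_simp
  rw [h8, h9]
  linarith

variable (G) in
/-- The value of an output set `S`: its volume inside `A` if `S` passes the final test. -/
noncomputable def score (A : Finset V) (T : ℕ) (S : Finset V) : ℝ≥0∞ :=
  open Classical in
  if (G.conductance S : EReal) ≤ 3 * theta G T ∧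
    (G.volume S : ℝ) ≤ 3 / 4 * G.volume Finset.univ then (G.volume (S ∩ A) : ℝ≥0∞) else 0

theorem volume_inter_add_volume_sdiff (S A : Finset V) :
    G.volume (S ∩ A) + G.volume (S \ A) = G.volume S := by
  unfold SimpleGraph.volume
  rw [← Finset.sum_inter_add_sum_sdiff S A]

/-- When the sample path stops, the potential is at most the expected value of the output, over the
choice of the budget. -/
theorem potential_le_score (hm : 2 ≤ G.volume Finset.univ) {φ : ℝ} (hT : timeLimit φ ≠ 0)
    {A : Finset V} (hA : (G.volume A : ℝ) ≤ 2 / 3 * G.volume Finset.univ) {k : ℕ}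
    (hk : k ≤ timeLimit φ) {S : Finset V} {c : ℝ} (hc : 0 ≤ c)
    (hterm : k = 0 ∨ (G.conductance S : EReal) < theta G (timeLimit φ)) :
    ENNReal.ofReal (potential G A (timeLimit φ) k S c) ≤ ∑ j : Fin (maxIndex G + 1),
      if c ≤ budget G φ j then
        budgetIndex (maxIndex G) j * (G.volume S * score G A (timeLimit φ) S) else 0 := by
  have hL : 0 < Real.log (G.volume Finset.univ) := by linarith [half_lt_log_volume G hm]
  have hT0 : (0 : ℝ) < timeLimit φ := by exact_mod_cast Nat.pos_of_ne_zero hT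
  have hγ := costScale_pos G (timeLimit φ)
  have hμm : (G.volume S : ℝ) ≤ G.volume Finset.univ := by
    exact_mod_cast G.volume_mono (Finset.subset_univ S)
  have hesc : (G.volume (S \ A) : ℝ) ≤
      ∑ y ∈ S, (G.degree y : ℝ) * escape G A k y := by
    unfold SimpleGraph.volume
    push_cast
    calc ∑ y ∈ S \ A, (G.degree y : ℝ) = ∑ y ∈ S \ A, (G.degree y : ℝ) * escape G A k y := by
          refine Finset.sum_congr rfl fun y hy => ?_
          rw [escape_of_notMem G (Finset.mem_sdiff.1 hy).2, mul_one]
      _ ≤ _ := Finset.sum_le_sum_of_subset_of_nonneg Finset.sdiff_subset fun y _ _ =>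
          mul_nonneg (Nat.cast_nonneg _) (escape_nonneg G A k y)
  have hW : 0 ≤ (G.volume S : ℝ) *
      (Real.log (G.volume Finset.univ) - Real.log (G.volume S)) := by
    rcases Nat.eq_zero_or_pos (G.volume S) with h0 | h0
    · simp [h0]
    · have := Real.log_le_log (by exact_mod_cast h0) hμm
      exact mul_nonneg (Nat.cast_nonneg _) (by linarith)
  have hpot : potential G A (timeLimit φ) k S c ≤ G.volume S - 10 * G.volume (S \ A)
      - c / (8 * costScale G (timeLimit φ))
      - G.volume S * ((timeLimit φ - k) / timeLimit φ) := by
    unfold potential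
    have h1 : c / (8 * costScale G (timeLimit φ)) ≤
        (c + 5 / 2 * Real.sqrt (timeLimit φ / Real.log (G.volume Finset.univ)) *
          (G.volume S * (Real.log (G.volume Finset.univ) - Real.log (G.volume S)))
        + G.volume S * (k / Real.sqrt (timeLimit φ / Real.log (G.volume Finset.univ))))
        / (8 * costScale G (timeLimit φ)) := by
      refine div_le_div_of_nonneg_right ?_ (by positivity)
      have : 0 ≤ 5 / 2 * Real.sqrt (timeLimit φ / Real.log (G.volume Finset.univ)) *
        (G.volume S * (Real.log (G.volume Finset.univ) - Real.log (G.volume S))) :=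
        mul_nonneg (by positivity) hW
      have : 0 ≤ (G.volume S : ℝ) *
        (k / Real.sqrt (timeLimit φ / Real.log (G.volume Finset.univ))) := by positivity
      linarith
    have h2 : 0 ≤ 5 / 8 / Real.log (G.volume Finset.univ) *
        (G.volume S * (Real.log (G.volume Finset.univ) - Real.log (G.volume S))) :=
      mul_nonneg (by positivity) hW
    linarith
  have hkT : (k : ℝ) ≤ timeLimit φ := by exact_mod_cast hk
  have hrest : 0 ≤ (G.volume S : ℝ) * (((timeLimit φ : ℝ) - k) / timeLimit φ) :=
    mul_nonneg (Nat.cast_nonneg _) (div_nonneg (by linarith) hT0.le)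
  have hcγ : 0 ≤ c / (8 * costScale G (timeLimit φ)) := by positivity
  have hnonpos : potential G A (timeLimit φ) k S c ≤ 0 →
      ENNReal.ofReal (potential G A (timeLimit φ) k S c) ≤ ∑ j : Fin (maxIndex G + 1),
        if c ≤ budget G φ j then
          budgetIndex (maxIndex G) j * (G.volume S * score G A (timeLimit φ) S) else 0 := by
    intro h
    rw [ENNReal.ofReal_of_nonpos h]
    exact zero_le
  have hq : (G.volume (S ∩ A) : ℝ) + G.volume (S \ A) = G.volume S := by
    exact_mod_cast volume_inter_add_volume_sdiff S A
  have hq0 : (0 : ℝ) ≤ G.volume (S \ A) := Nat.cast_nonneg _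
  rcases hterm with rfl | hterm
  · refine hnonpos (hpot.trans ?_)
    rw [Nat.cast_zero, sub_zero, div_self hT0.ne', mul_one]
    linarith
  by_cases hvol : (G.volume S : ℝ) ≤ 3 / 4 * G.volume Finset.univ
  swap
  -- a set that is too large has at least a ninth of its volume outside `A`
  · have : (G.volume (S ∩ A) : ℝ) ≤ G.volume A := by
      exact_mod_cast G.volume_mono Finset.inter_subset_right
    exact hnonpos (hpot.trans (by linarith))
  rcases Nat.eq_zero_or_pos (G.volume S) with h0 | h0
  · refine hnonpos (hpot.trans ?_)
    rw [h0] at hrest ⊢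
    push_cast at hrest ⊢
    linarith
  have hscore : score G A (timeLimit φ) S = G.volume (S ∩ A) := by
    unfold score
    refine if_pos ⟨hterm.le.trans ?_, hvol⟩
    rw [theta_of_ne_zero G hT, show (3 : EReal) = ((3 : ℝ) : EReal) from rfl, ← EReal.coe_mul,
      EReal.coe_le_coe_iff]
    linarith [Real.sqrt_nonneg
      (4 * (timeLimit φ : ℝ)⁻¹ * Real.log (G.volume Finset.univ))]
  have hμ : (0 : ℝ) < G.volume S := by exact_mod_cast h0
  have hsum : (∑ j : Fin (maxIndex G + 1), if c ≤ budget G φ j then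
        budgetIndex (maxIndex G) j * (G.volume S * score G A (timeLimit φ) S) else 0) =
      G.volume (S ∩ A) * (G.volume S * ∑ j : Fin (maxIndex G + 1),
        if c ≤ budget G φ j then budgetIndex (maxIndex G) j else 0) := by
    rw [Finset.mul_sum, Finset.mul_sum]
    refine Finset.sum_congr rfl fun j _ => ?_
    rw [hscore]
    split_ifs <;> ring
  rw [hsum]
  refine le_trans ?_ (mul_le_mul_right (le_volume_mul_sum_budgetIndex hm φ h0 hc) _)
  rw [← ENNReal.ofReal_natCast, ← ENNReal.ofReal_mul (Nat.cast_nonneg _)]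
  refine ENNReal.ofReal_le_ofReal (hpot.trans ?_)
  set r := c / (8 * costScale G (timeLimit φ) * G.volume S) with hr
  have hr0 : 0 ≤ r := by positivity
  have hcr : c / (8 * costScale G (timeLimit φ)) = G.volume S * r := by
    rw [hr]; field_simp
  rw [hcr]
  nlinarith [mul_nonneg hq0 hr0]

/-- The potential at the start of a sample path. -/
theorem le_potential_singleton (hm : 2 ≤ G.volume Finset.univ) (A : Finset V) {T : ℕ} (hT : T ≠ 0)
    {x : V} (hx : 0 < G.degree x) :
    (G.degree x : ℝ) * (1 / 4 - 10 * escape G A T x) ≤ potential G A T T {x} (G.degree x) := by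
  have hL : 0 < Real.log (G.volume Finset.univ) := by linarith [half_lt_log_volume G hm]
  have hT0 : (0 : ℝ) < T := by exact_mod_cast Nat.pos_of_ne_zero hT
  have hd : (1 : ℝ) ≤ G.degree x := by exact_mod_cast hx
  have hvol : G.volume {x} = G.degree x := by simp [SimpleGraph.volume]
  have hlog := Real.log_nonneg hd
  unfold potential costScale
  rw [hvol, Finset.sum_singleton, sub_self, zero_div, mul_zero, sub_zero]
  set L := Real.log (G.volume Finset.univ) with hLdef
  set d : ℝ := (G.degree x : ℝ) with hddef
  set e := escape G A T x
  have h1 : Real.sqrt (T / L) * L = Real.sqrt (T * L) := by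
    rw [Real.sqrt_div hT0.le, Real.sqrt_mul hT0.le]
    have := Real.mul_self_sqrt hL.le
    have h0 := Real.sqrt_pos.2 hL
    field_simp
    linarith
  have h2 : T / Real.sqrt (T / L) = Real.sqrt (T * L) := by
    rw [Real.sqrt_div hT0.le, Real.sqrt_mul hT0.le]
    have := Real.mul_self_sqrt hT0.le
    have h0 := Real.sqrt_pos.2 hL
    have h3 := Real.sqrt_pos.2 hT0
    field_simp
    linarith
  have hs := Real.sqrt_nonneg (T / L)
  have hs' := Real.sqrt_nonneg (T * L)
  have h3 : (d + 5 / 2 * Real.sqrt (T / L) * (d * (L - Real.log d)) + d * (T / Real.sqrt (T / L)))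
      / (8 * (1 + 4 * Real.sqrt (T * L))) ≤ d / 8 := by
    rw [div_le_iff₀ (by positivity), h2]
    have h4 : 5 / 2 * Real.sqrt (T / L) * (d * (L - Real.log d)) ≤
        5 / 2 * d * Real.sqrt (T * L) := by
      rw [← h1]
      have : 0 ≤ Real.sqrt (T / L) * d * Real.log d := by positivity
      nlinarith
    have : 0 ≤ d * Real.sqrt (T * L) := by positivity
    nlinarith
  have h5 : 5 / 8 / L * (d * (L - Real.log d)) ≤ 5 / 8 * d := by
    have : 5 / 8 / L * (d * (L - Real.log d)) ≤ 5 / 8 / L * (d * L) := by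
      gcongr
      linarith
    refine this.trans (le_of_eq ?_)
    field_simp
  linarith

end

end EvoNibble

/-! ### The coupling of the walk with the evolving set process -/

namespace EvoNibble

open MeasureTheory in
/-- The integral of the positive part dominates the integral. -/
theorem ofReal_integral_le_lintegral {α : Type*} [MeasurableSpace α] {μ : Measure α} {f : α → ℝ}
    (hf : Integrable f μ) : ENNReal.ofReal (∫ a, f a ∂μ) ≤ ∫⁻ a, ENNReal.ofReal (f a) ∂μ := by
  rw [integral_eq_lintegral_pos_part_sub_lintegral_neg_part hf]
  refine (ENNReal.ofReal_le_ofReal (sub_le_self _ ENNReal.toReal_nonneg)).trans ?_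
  exact ENNReal.ofReal_toReal_le

open MeasureTheory Set in
/-- The substitution `z = p u` for `u` uniform on the unit interval. -/
theorem ofReal_mul_lintegral_unitInterval {p : ℝ} (hp : 0 ≤ p) {f : ℝ → ℝ≥0∞}
    (hf : Measurable f) : ENNReal.ofReal p * ∫⁻ u : unitInterval, f (p * u) =
      ∫⁻ z in Ioc 0 p, f z := by
  rcases hp.eq_or_lt with rfl | hp
  · simp
  have h1 : (∫⁻ u : unitInterval, f (p * u)) = ∫⁻ u in Icc (0 : ℝ) 1, f (p * u) :=
    lintegral_subtype_comap measurableSet_Icc fun u : ℝ => f (p * u)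
  rw [h1, setLIntegral_congr Ioc_ae_eq_Icc.symm, ← lintegral_indicator measurableSet_Ioc,
    ← lintegral_indicator measurableSet_Ioc]
  conv_rhs => rw [← Real.smul_map_volume_mul_left hp.ne', abs_of_pos hp]
  rw [lintegral_smul_measure, lintegral_map (hf.indicator measurableSet_Ioc) (by fun_prop),
    smul_eq_mul]
  congr 1
  refine lintegral_congr fun u => ?_
  simp only [indicator_apply, mem_Ioc]
  have h2 : 0 < p * u ↔ 0 < u := mul_pos_iff_of_pos_left hp
  have h3 : p * u ≤ p ↔ u ≤ 1 := by
    constructor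
    · intro h; nlinarith
    · intro h; nlinarith
  simp only [h2, h3]

section

variable {V : Type*} [Fintype V] [LinearOrder V] (G : SimpleGraph V) [DecidableRel G.Adj]

theorem degree_mul_expect_walkStep {y : V} (hy : 0 < G.degree y) (f : V → ℝ≥0∞) :
    (G.degree y : ℝ≥0∞) * (walkStep G y).expect f =
      2⁻¹ * (G.degree y * f y + ∑ w ∈ G.neighborFinset y, f w) := by
  have hne : (G.neighborFinset y).Nonempty := by
    rw [← Finset.card_pos, SimpleGraph.card_neighborFinset_eq_degree]
    exact hy
  have h1 : (PMF.uniformOfFinset (G.neighborFinset y) hne).expect f =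
      (G.degree y : ℝ≥0∞)⁻¹ * ∑ w ∈ G.neighborFinset y, f w := by
    rw [PMF.expect_fintype, Finset.mul_sum, ← Finset.sum_ite_mem_eq (G.neighborFinset y)]
    refine Finset.sum_congr rfl fun w _ => ?_
    rw [PMF.uniformOfFinset_apply, SimpleGraph.card_neighborFinset_eq_degree]
    split_ifs <;> simp
  unfold walkStep
  rw [PMF.expect_bind, PMF.expect_fintype, Fintype.sum_bool]
  simp only [hne, and_true, dite_true, Bool.false_eq_true, dite_false, PMF.uniformOfFintype_apply,
    Fintype.card_bool, PMF.expect_pure, h1]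
  have hd0 : (G.degree y : ℝ≥0∞) ≠ 0 := by exact_mod_cast hy.ne'
  have hd1 : (G.degree y : ℝ≥0∞) * (G.degree y : ℝ≥0∞)⁻¹ = 1 :=
    ENNReal.mul_inv_cancel hd0 (ENNReal.natCast_ne_top _)
  push_cast
  calc (G.degree y : ℝ≥0∞) * (2⁻¹ * ((G.degree y : ℝ≥0∞)⁻¹ * ∑ w ∈ G.neighborFinset y, f w)
        + 2⁻¹ * f y)
      = 2⁻¹ * ((G.degree y * (G.degree y : ℝ≥0∞)⁻¹) * (∑ w ∈ G.neighborFinset y, f w)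
          + G.degree y * f y) := by ring
    _ = _ := by rw [hd1, one_mul, add_comm]

theorem sum_degree_mul_expect_walkStep {S : Finset V} (hS : ∀ y ∈ S, 0 < G.degree y)
    (f : V → ℝ≥0∞) : ∑ y ∈ S, (G.degree y : ℝ≥0∞) * (walkStep G y).expect f =
      ∑ x, G.degree x * (ENNReal.ofReal (transTo G S x) * f x) := by
  rw [Finset.sum_congr rfl fun y hy => degree_mul_expect_walkStep G (hS y hy) f, ← Finset.mul_sum,
    Finset.sum_add_distrib, G.sum_sum_neighborFinset, ← Finset.sum_ite_mem_eq S,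
    ← Finset.sum_add_distrib, Finset.mul_sum]
  refine Finset.sum_congr rfl fun x _ => ?_
  have h1 := degree_mul_transTo G S x
  have h2 : (G.degree x : ℝ≥0∞) * ENNReal.ofReal (transTo G S x) =
      2⁻¹ * (G.edgesInto S x + if x ∈ S then (G.degree x : ℝ≥0∞) else 0) := by
    rw [← ENNReal.ofReal_natCast, ← ENNReal.ofReal_mul (Nat.cast_nonneg _), h1, div_eq_inv_mul,
      ENNReal.ofReal_mul (by norm_num), ENNReal.ofReal_inv_of_pos (by norm_num),
      ENNReal.ofReal_add (Nat.cast_nonneg _) (by split_ifs <;> positivity)]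
    split_ifs <;> simp
  rw [← mul_assoc, h2, nsmul_eq_mul]
  split_ifs <;> ring

open MeasureTheory in
theorem measurable_comp_changes {β : Type*} [MeasurableSpace β] (s : Machine V)
    (f : List V → β) : Measurable fun z : ℝ => f (s.changes G z) := by
  let _ : MeasurableSpace (List V) := ⊤
  refine (measurable_from_top (f := f)).comp ?_
  unfold Machine.changes
  induction s.bd.keys with
  | nil => exact measurable_const
  | cons y l ih =>
    simp only [List.filter_cons]
    refine Measurable.ite ?_ (Measurable.comp (g := List.cons y) measurable_from_top ih) ih
    by_cases hc : s.mem.contains y = true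
    · simp only [hc, bne_iff_ne, ne_eq, decide_eq_true_eq, not_le]
      exact measurableSet_Ioi
    · convert measurableSet_Iic (a := s.prob G y) using 1
      ext z
      simp [hc]

open MeasureTheory in
theorem expect_chooseChanges (s : Machine V) (x : V) (f : List V → ℝ≥0∞) :
    (chooseChanges G s x).expect f =
      ∫⁻ u : unitInterval, f (s.changes G (s.prob G x * u)) := by
  let _ : MeasurableSpace (List V) := ⊤
  have _ : MeasurableSingletonClass (List V) := ⟨fun _ => trivial⟩
  have _ : Countable V := Finite.to_countable
  rw [← lintegral_map (f := f) (g := fun u : unitInterval => s.changes G (s.prob G x * u))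
    measurable_from_top (measurable_changes G s _), lintegral_countable']
  refine tsum_congr fun D => ?_
  rw [mul_comm]
  congr 1

variable {G}

theorem Machine.Represents.prob {s : Machine V} {S : Finset V} (h : s.Represents G S) (y : V) :
    s.prob G y = transTo G S y := by
  unfold Machine.prob transTo
  rw [h.edgesTo, h.mem]
  simp

/-- Only vertices of the two-sided boundary can enter or leave the set. -/
theorem Machine.Represents.symmDiff_changes {s : Machine V} {S : Finset V}
    (h : s.Represents G S) (hS : ∀ y ∈ S, 0 < G.degree y) {z : ℝ} (h0 : 0 < z) (h1 : z ≤ 1) :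
    symmDiff S (s.changes G z).toFinset = level G S z := by
  ext y
  have hk : y ∈ (s.changes G z).toFinset ↔
      y ∈ s.bd.keys ∧ ¬ (z ≤ transTo G S y ↔ y ∈ S) := by
    unfold Machine.changes
    rw [List.mem_toFinset, List.mem_filter, h.prob, h.mem]
    simp
  rw [Finset.mem_symmDiff, hk, h.mem_keys_bd, mem_level]
  have hadd := G.edgesInto_add_compl S y
  by_cases hy : y ∈ S
  · by_cases he : 0 < G.edgesInto Sᶜ y
    · simp [hy, he]
    · have : transTo G S y = 1 := by
        have h2 : (G.degree y : ℝ) ≠ 0 := by exact_mod_cast (hS y hy).ne'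
        have h3 : G.edgesInto S y = G.degree y := by omega
        unfold transTo
        rw [if_pos hy, h3, div_self h2]
        norm_num
      simp [hy, he, this, h1]
  · by_cases he : 0 < G.edgesInto S y
    · simp [hy, he]
    · have : transTo G S y = 0 := by
        unfold transTo
        rw [if_neg hy, Nat.eq_zero_of_not_pos he]
        simp
      simp [hy, he, this, h0]

open MeasureTheory in
/-- The Diaconis–Fill coupling: if the particle is distributed over `S` proportionally to the
degrees, then after one step it is distributed over the new set in the same way, and the new set is
a step of the volume-biased evolving set process. -/
theorem sum_degree_mul_expect_step {s : Machine V} {S : Finset V} (h : s.Represents G S)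
    (hS : ∀ y ∈ S, 0 < G.degree y) (f : V → List V → ℝ≥0∞) :
    ∑ y ∈ S, (G.degree y : ℝ≥0∞) *
        (walkStep G y).expect (fun x => (chooseChanges G s x).expect (f x)) =
      ∫⁻ z in Set.Ioc (0 : ℝ) 1, ∑ x ∈ symmDiff S (s.changes G z).toFinset,
        (G.degree x : ℝ≥0∞) * f x (s.changes G z) := by
  have h1 : ∀ x, ENNReal.ofReal (transTo G S x) * (chooseChanges G s x).expect (f x) =
      ∫⁻ z in Set.Ioc (0 : ℝ) 1, if z ≤ transTo G S x then f x (s.changes G z) else 0 := by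
    intro x
    have hm := measurable_comp_changes G s (f x)
    rw [expect_chooseChanges, h.prob, ofReal_mul_lintegral_unitInterval (transTo_nonneg G S x) hm,
      ← lintegral_indicator measurableSet_Ioc, ← lintegral_indicator measurableSet_Ioc]
    refine lintegral_congr fun z => ?_
    have := transTo_le_one G S x
    simp only [Set.indicator_apply, Set.mem_Ioc]
    by_cases h2 : z ≤ transTo G S x
    · simp [h2, h2.trans this]
    · simp [h2]
  rw [sum_degree_mul_expect_walkStep G hS]
  simp only [h1]
  have h2 : ∀ x, Measurable fun z : ℝ =>
      if z ≤ transTo G S x then f x (s.changes G z) else 0 := fun x =>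
    Measurable.ite measurableSet_Iic (measurable_comp_changes G s (f x)) measurable_const
  rw [Finset.sum_congr rfl fun x _ => (lintegral_const_mul (G.degree x : ℝ≥0∞) (h2 x)).symm,
    ← lintegral_finsetSum _ fun x _ => (h2 x).const_mul _]
  refine setLIntegral_congr_fun measurableSet_Ioc fun z hz => ?_
  rw [h.symmDiff_changes hS hz.1 hz.2, level, Finset.sum_filter]
  refine Finset.sum_congr rfl fun x _ => ?_
  split_ifs <;> simp

/-! ### The value of a run -/

theorem lt_theta_iff {s : Machine V} {S : Finset V} (h : s.Represents G S) (T : ℕ) :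
    (((s.bdry : ℝ) / (s.vol : ℝ) : ℝ) : EReal) < theta G T ↔
      (G.conductance S : EReal) < theta G T := by
  rw [h.bdry, h.vol, SimpleGraph.conductance]

theorem le_conductance_sq (hm : 2 ≤ G.volume Finset.univ) {T : ℕ} (hT : T ≠ 0) {S : Finset V}
    (h : ¬ (G.conductance S : EReal) < theta G T) :
    4 * (T : ℝ)⁻¹ * Real.log (G.volume Finset.univ) ≤ G.conductance S ^ 2 ∧ 0 < G.volume S := by
  have hL : 0 < Real.log (G.volume Finset.univ) := by linarith [half_lt_log_volume G hm]
  have hT0 : (0 : ℝ) < T := by exact_mod_cast Nat.pos_of_ne_zero hT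
  rw [theta_of_ne_zero G hT, EReal.coe_lt_coe_iff, not_lt] at h
  refine ⟨(Real.sqrt_le_left (conductance_nonneg G S)).1 h, Nat.pos_of_ne_zero fun h0 => ?_⟩
  have h1 : 0 < Real.sqrt (4 * (T : ℝ)⁻¹ * Real.log (G.volume Finset.univ)) :=
    Real.sqrt_pos.2 (by positivity)
  rw [SimpleGraph.conductance, h0, Nat.cast_zero, div_zero] at h
  linarith

theorem level_degree_pos {S : Finset V} (hS : ∀ y ∈ S, 0 < G.degree y) {z : ℝ} (hz : 0 < z) :
    ∀ y ∈ level G S z, 0 < G.degree y := by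
  intro y hy
  rw [mem_level] at hy
  refine Nat.pos_of_ne_zero fun h0 => ?_
  have hyS : y ∉ S := fun h => (hS y h).ne' h0
  unfold transTo at hy
  rw [if_neg hyS, h0] at hy
  simp at hy
  linarith

open MeasureTheory in
/-- The expected value of the output of a run, averaged over the position of the particle in the
current set and summed over the budgets that are not yet exceeded, is at least the potential. -/
theorem potential_le_run (hm : 2 ≤ G.volume Finset.univ) {φ : ℝ} (hT : timeLimit φ ≠ 0)
    {A : Finset V} (hA : (G.volume A : ℝ) ≤ 2 / 3 * G.volume Finset.univ) (k : ℕ) :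
    ∀ (s : Machine V) (S : Finset V), k ≤ timeLimit φ → s.Represents G S →
      (∀ y ∈ S, 0 < G.degree y) → ¬ (G.conductance S : EReal) < theta G (timeLimit φ) →
      ENNReal.ofReal (potential G A (timeLimit φ) k S s.cost) ≤ ∑ j : Fin (maxIndex G + 1),
        if (s.cost : ℝ) ≤ budget G φ j then
          budgetIndex (maxIndex G) j * ∑ y ∈ S, (G.degree y : ℝ≥0∞) *
            (run G (budget G φ j) (theta G (timeLimit φ)) k (s.atPos y)).expect
              (fun r => score G A (timeLimit φ) r.1) else 0 := by
  induction k with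
  | zero =>
    intro s S hk hR hS hcond
    refine (potential_le_score hm hT hA hk (Nat.cast_nonneg _) (Or.inl rfl)).trans ?_
    refine Finset.sum_le_sum fun j _ => ?_
    split_ifs with hj
    · refine le_of_eq ?_
      congr 1
      simp only [run, PMF.expect_pure, (hR.atPos _).toFinset]
      rw [← Finset.sum_mul, SimpleGraph.volume, Nat.cast_sum]
    · exact le_rfl
  | succ k ih =>
    intro s S hk hR hS hcond
    obtain ⟨hφ, hvol⟩ := le_conductance_sq hm hT hcond
    -- the value of the run after the particle has moved to `x` and the changes `D` are selected
    let next : Fin (maxIndex G + 1) → V → List V → ℝ≥0∞ := fun j x D =>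
      if budget G φ j < (s.stageOne G x D).cost then
        score G A (timeLimit φ) (symmDiff S D.toFinset)
      else if (G.conductance (symmDiff S D.toFinset) : EReal) < theta G (timeLimit φ) then
        score G A (timeLimit φ) (symmDiff S D.toFinset)
      else (run G (budget G φ j) (theta G (timeLimit φ)) k
        ((s.stageOne G x D).stageTwo G D)).expect fun r => score G A (timeLimit φ) r.1
    have hrun : ∀ (j : Fin (maxIndex G + 1)),
        ∑ y ∈ S, (G.degree y : ℝ≥0∞) *
          (run G (budget G φ j) (theta G (timeLimit φ)) (k + 1) (s.atPos y)).expect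
              (fun r => score G A (timeLimit φ) r.1) =
        ∫⁻ z in Set.Ioc (0 : ℝ) 1, ∑ x ∈ symmDiff S (s.changes G z).toFinset,
          (G.degree x : ℝ≥0∞) * next j x (s.changes G z) := by
      intro j
      rw [← sum_degree_mul_expect_step hR hS]
      refine Finset.sum_congr rfl fun y _ => ?_
      congr 1
      rw [run, PMF.expect_bind]
      refine congrArg (PMF.expect _) (funext fun x => ?_)
      rw [PMF.expect_bind]
      unfold PMF.expect
      refine tsum_congr fun D => ?_
      by_cases hD : chooseChanges G s x D = 0
      · have hD' : chooseChanges G (s.atPos y) x D = 0 := hD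
        rw [hD, hD', zero_mul, zero_mul]
      obtain ⟨z, rfl⟩ := exists_eq_changes_of_mem_support G ((PMF.mem_support_iff _ _).2 hD)
      change chooseChanges G s x _ * _ = _
      congr 1
      have hR2 : ((s.stageOne G x (s.changes G z)).stageTwo G (s.changes G z)).Represents G
          (symmDiff S (s.changes G z).toFinset) :=
        (hR.stageOne x _).stageTwo (Machine.changes_nodup s z)
      have hR1 : ((s.atPos y).stageOne G x (s.changes G z)).toFinset = S :=
        (hR.stageOne x _).toFinset
      change PMF.expect _ _ = next j x _
      simp only [hR1]
      change PMF.expect (if budget G φ j < (s.stageOne G x (s.changes G z)).cost then _ else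
        if ((((s.stageOne G x (s.changes G z)).stageTwo G (s.changes G z)).bdry /
          ((s.stageOne G x (s.changes G z)).stageTwo G (s.changes G z)).vol : ℝ) : EReal) <
          theta G (timeLimit φ) then PMF.pure
            (((s.stageOne G x (s.changes G z)).stageTwo G (s.changes G z)).toFinset, _) else
          run G (budget G φ j) (theta G (timeLimit φ)) k
            ((s.stageOne G x (s.changes G z)).stageTwo G (s.changes G z))) _ = _
      simp only [lt_theta_iff hR2, hR2.toFinset, next]
      split_ifs <;> first | exact PMF.expect_pure _ _ | rfl
    simp only [hrun]
    have hmeas : ∀ j : Fin (maxIndex G + 1), Measurable fun z : ℝ =>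
        ∑ x ∈ symmDiff S (s.changes G z).toFinset,
          (G.degree x : ℝ≥0∞) * next j x (s.changes G z) := fun j =>
      measurable_comp_changes G s fun D => ∑ x ∈ symmDiff S D.toFinset,
        (G.degree x : ℝ≥0∞) * next j x D
    have hint : (∑ j : Fin (maxIndex G + 1), if (s.cost : ℝ) ≤ budget G φ j then
          budgetIndex (maxIndex G) j * ∫⁻ z in Set.Ioc (0 : ℝ) 1,
            ∑ x ∈ symmDiff S (s.changes G z).toFinset,
              (G.degree x : ℝ≥0∞) * next j x (s.changes G z) else 0) =
        ∫⁻ z in Set.Ioc (0 : ℝ) 1, ∑ j : Fin (maxIndex G + 1),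
          if (s.cost : ℝ) ≤ budget G φ j then budgetIndex (maxIndex G) j *
            ∑ x ∈ symmDiff S (s.changes G z).toFinset,
              (G.degree x : ℝ≥0∞) * next j x (s.changes G z) else 0 := by
      rw [lintegral_finsetSum]
      · refine Finset.sum_congr rfl fun j _ => ?_
        split_ifs
        · rw [lintegral_const_mul _ (hmeas j)]
        · simp
      · intro j _
        split_ifs
        · exact (hmeas j).const_mul _
        · exact measurable_const
    rw [hint]
    refine (ENNReal.ofReal_le_ofReal (potential_succ_le hm A hT k hvol hφ s.cost)).trans ?_
    unfold evolve
    refine (ofReal_integral_le_lintegral (integrable_level G S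
      (fun R => potential G A (timeLimit φ) k R (s.cost + G.volume (symmDiff S R) + G.boundary S))
      0 1)).trans ?_
    refine setLIntegral_mono' measurableSet_Ioc fun z hz => ?_
    have hlev := hR.symmDiff_changes hS hz.1 hz.2
    have hnd := Machine.changes_nodup (G := G) s z
    rw [hlev]
    have hcost : (s.cost : ℝ) + G.volume (symmDiff S (level G S z)) + G.boundary S =
        (s.cost + (((s.changes G z).map fun y => G.degree y).sum + s.bdry) : ℕ) := by
      rw [← hlev, symmDiff_symmDiff_cancel_left, sum_map_degree_eq_volume G hnd, hR.bdry]
      push_cast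
      ring
    rw [hcost]
    set c' := s.cost + (((s.changes G z).map fun y => G.degree y).sum + s.bdry) with hc'
    have hle : ∀ j : Fin (maxIndex G + 1), (c' : ℝ) ≤ budget G φ j → (s.cost : ℝ) ≤ budget G φ j :=
      fun j hj => le_trans (by exact_mod_cast Nat.le_add_right _ _) hj
    have hnext : ∀ (j : Fin (maxIndex G + 1)) (x : V), (c' : ℝ) ≤ budget G φ j →
        next j x (s.changes G z) =
          if (G.conductance (level G S z) : EReal) < theta G (timeLimit φ) then
            score G A (timeLimit φ) (level G S z)
          else (run G (budget G φ j) (theta G (timeLimit φ)) k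
            ((s.stageOne G x (s.changes G z)).stageTwo G (s.changes G z))).expect
              fun r => score G A (timeLimit φ) r.1 := by
      intro j x hj
      simp only [next, hlev]
      exact if_neg (not_lt.2 hj)
    by_cases hcond' : (G.conductance (level G S z) : EReal) < theta G (timeLimit φ)
    · refine (potential_le_score hm hT hA (by omega) (Nat.cast_nonneg _)
        (Or.inr hcond')).trans ?_
      refine Finset.sum_le_sum fun j _ => ?_
      by_cases hj : (c' : ℝ) ≤ budget G φ j
      · rw [if_pos hj, if_pos (hle j hj)]
        simp only [hnext j _ hj, if_pos hcond']
        rw [← Finset.sum_mul, SimpleGraph.volume, Nat.cast_sum]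
      · rw [if_neg hj]
        exact zero_le
    · have hR2 : ((s.stageOne G s.pos (s.changes G z)).stageTwo G (s.changes G z)).Represents G
          (level G S z) := hlev ▸ (hR.stageOne s.pos _).stageTwo hnd
      have hcost2 : ((s.stageOne G s.pos (s.changes G z)).stageTwo G (s.changes G z)).cost = c' :=
        Machine.cost_stageTwo _ _
      have := ih _ _ (by omega) hR2 (level_degree_pos hS hz.1) hcond'
      rw [hcost2] at this
      refine this.trans (Finset.sum_le_sum fun j _ => ?_)
      by_cases hj : (c' : ℝ) ≤ budget G φ j
      · rw [if_pos hj, if_pos (hle j hj)]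
        simp only [hnext j _ hj, if_neg hcond', ← Machine.stageTwo_atPos]
        exact le_rfl
      · rw [if_neg hj]
        exact zero_le

end

end EvoNibble

/-! ### The expected overlap with a sparse set -/

namespace EvoNibble

variable {V : Type*} [Fintype V] [LinearOrder V] (G : SimpleGraph V) [DecidableRel G.Adj]

theorem Machine.init_atPos (x : V) : (Machine.init G x).atPos x = Machine.init G x :=
  (Machine.toggle_atPos G _ x x).symm

theorem expect_output (hG : 0 < G.volume Finset.univ) (φ : ℝ) (A : Finset V) :
    (output G hG φ).expect (fun S => (G.volume (S ∩ A) : ℝ≥0∞)) =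
      ∑ x, (G.volume Finset.univ : ℝ≥0∞)⁻¹ * (G.degree x *
        ∑ j : Fin (maxIndex G + 1), budgetIndex (maxIndex G) j *
          (generateSample G x (timeLimit φ) (budget G φ j)).expect
            fun r => score G A (timeLimit φ) r.1) := by
  unfold output
  rw [PMF.expect_map]
  unfold evoNibble
  simp only [PMF.expect_bind, PMF.expect_pure, Function.comp_def]
  rw [PMF.expect_fintype]
  refine Finset.sum_congr rfl fun x _ => ?_
  rw [startVertex_apply, mul_comm (G.degree x : ℝ≥0∞), mul_assoc]
  congr 2
  rw [PMF.expect_fintype]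
  refine Finset.sum_congr rfl fun j _ => ?_
  congr 2
  funext r
  unfold score
  split_ifs
  · rfl
  · simp [SimpleGraph.volume]

variable {G}

theorem potential_le_generateSample (hm : 2 ≤ G.volume Finset.univ) {φ : ℝ}
    (hT : timeLimit φ ≠ 0) {A : Finset V} (hA : (G.volume A : ℝ) ≤ 2 / 3 * G.volume Finset.univ)
    {x : V} (hx : 0 < G.degree x) :
    ENNReal.ofReal (potential G A (timeLimit φ) (timeLimit φ) {x} (G.degree x)) ≤
      G.degree x * ∑ j : Fin (maxIndex G + 1), budgetIndex (maxIndex G) j *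
          (generateSample G x (timeLimit φ) (budget G φ j)).expect
            fun r => score G A (timeLimit φ) r.1 := by
  rw [Finset.mul_sum]
  by_cases hcond : (G.conductance {x} : EReal) < theta G (timeLimit φ)
  · refine (potential_le_score hm hT hA le_rfl (Nat.cast_nonneg _) (Or.inr hcond)).trans ?_
    refine Finset.sum_le_sum fun j _ => ?_
    split_ifs
    · unfold generateSample
      rw [if_pos (Or.inl hcond), PMF.expect_pure, mul_left_comm]
      simp [SimpleGraph.volume]
    · exact zero_le
  · have h := potential_le_run hm hT hA (timeLimit φ) (Machine.init G x) {x} le_rfl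
      (Machine.represents_init x) (by simpa using hx) hcond
    rw [Machine.cost_init] at h
    refine h.trans (Finset.sum_le_sum fun j _ => ?_)
    split_ifs with hj
    · unfold generateSample
      rw [if_neg (by simp only [hcond, hT, not_lt.2 hj, or_self, not_false_eq_true]),
        Finset.sum_singleton, Machine.init_atPos, mul_left_comm]
    · exact zero_le

theorem two_mul_degree_le_volume (x : V) : 2 * G.degree x ≤ G.volume Finset.univ := by
  have h1 : G.volume (insert x (G.neighborFinset x)) ≤ G.volume Finset.univ :=
    G.volume_mono (Finset.subset_univ _)
  rw [G.volume_insert (by simp)] at h1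
  have h2 : G.degree x ≤ G.volume (G.neighborFinset x) := by
    rw [← G.card_neighborFinset_eq_degree, Finset.card_eq_sum_ones]
    refine Finset.sum_le_sum fun w hw => ?_
    rw [SimpleGraph.mem_neighborFinset] at hw
    exact (G.degree_pos_iff_exists_adj w).2 ⟨x, hw.symm⟩
  omega

theorem score_singleton_of_eq_zero (A : Finset V) {x : V} (hx : x ∈ A) :
    score G A 0 {x} = G.degree x := by
  have h1 : G.volume {x} = G.degree x := by simp [SimpleGraph.volume]
  unfold score
  rw [if_pos]
  · rw [Finset.singleton_inter_of_mem hx, h1]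
  · refine ⟨?_, ?_⟩
    · rw [theta, if_pos rfl, EReal.mul_top_of_pos (by norm_num)]
      exact le_top
    · have : (2 : ℝ) * G.degree x ≤ G.volume Finset.univ := by
        exact_mod_cast two_mul_degree_le_volume x
      have : (0 : ℝ) ≤ G.volume Finset.univ := Nat.cast_nonneg _
      rw [h1]
      linarith

theorem le_sum_degree_mul_generateSample (hm : 2 ≤ G.volume Finset.univ) {φ : ℝ} (hφ : 0 < φ)
    {A : Finset V} (hA0 : 0 < G.volume A)
    (hA : (G.volume A : ℝ) ≤ 2 / 3 * G.volume Finset.univ) (hAφ : G.conductance A ≤ φ) :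
    ENNReal.ofReal (G.volume A / 20) ≤ ∑ x ∈ A, G.degree x *
      ∑ j : Fin (maxIndex G + 1), budgetIndex (maxIndex G) j *
          (generateSample G x (timeLimit φ) (budget G φ j)).expect
            fun r => score G A (timeLimit φ) r.1 := by
  have hvol : ∑ x ∈ A, (G.degree x : ℝ) = G.volume A := by
    unfold SimpleGraph.volume; push_cast; rfl
  have hμ : (0 : ℝ) < G.volume A := by exact_mod_cast hA0
  by_cases hT : timeLimit φ = 0
  · have h1 : ∀ x ∈ A, (G.degree x : ℝ≥0∞) ≤ G.degree x *
        ∑ j : Fin (maxIndex G + 1), budgetIndex (maxIndex G) j *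
          (generateSample G x (timeLimit φ) (budget G φ j)).expect
            fun r => score G A (timeLimit φ) r.1 := by
      intro x hx
      have h2 : ∀ j : Fin (maxIndex G + 1),
          (generateSample G x (timeLimit φ) (budget G φ j)).expect
            (fun r => score G A (timeLimit φ) r.1) = G.degree x := by
        intro j
        unfold generateSample
        rw [if_pos (Or.inr (Or.inl hT)), PMF.expect_pure, hT]
        exact score_singleton_of_eq_zero A hx
      simp only [h2]
      rw [← Finset.sum_mul, ← tsum_fintype (L := .unconditional _), PMF.tsum_coe, one_mul]
      exact_mod_cast Nat.le_mul_self _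
    refine le_trans ?_ (Finset.sum_le_sum h1)
    rw [← Nat.cast_sum, ← ENNReal.ofReal_natCast]
    refine ENNReal.ofReal_le_ofReal ?_
    change (G.volume A : ℝ) / 20 ≤ G.volume A
    linarith
  · have h1 : ∀ x ∈ A, ENNReal.ofReal ((G.degree x : ℝ) *
        (1 / 4 - 10 * escape G A (timeLimit φ) x)) ≤ G.degree x *
        ∑ j : Fin (maxIndex G + 1), budgetIndex (maxIndex G) j *
          (generateSample G x (timeLimit φ) (budget G φ j)).expect
            fun r => score G A (timeLimit φ) r.1 := by
      intro x _
      rcases Nat.eq_zero_or_pos (G.degree x) with h0 | h0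
      · simp [h0]
      · exact (ENNReal.ofReal_le_ofReal (le_potential_singleton hm A hT h0)).trans
          (potential_le_generateSample hm hT hA h0)
    refine le_trans ?_ (Finset.sum_le_sum h1)
    have h2 : ENNReal.ofReal (∑ x ∈ A, (G.degree x : ℝ) *
        (1 / 4 - 10 * escape G A (timeLimit φ) x)) ≤ ∑ x ∈ A, ENNReal.ofReal ((G.degree x : ℝ) *
        (1 / 4 - 10 * escape G A (timeLimit φ) x)) :=
      Finset.le_sum_of_subadditive _ ENNReal.ofReal_zero.le (fun _ _ => ENNReal.ofReal_add_le) _ _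
    refine le_trans (ENNReal.ofReal_le_ofReal ?_) h2
    have h3 := sum_degree_mul_escape_le G A (timeLimit φ)
    have h4 : ∑ x ∈ A, (G.degree x : ℝ) * (1 / 4 - 10 * escape G A (timeLimit φ) x) =
        G.volume A / 4 - 10 * ∑ x ∈ A, (G.degree x : ℝ) * escape G A (timeLimit φ) x := by
      rw [← hvol, Finset.sum_div, Finset.mul_sum, ← Finset.sum_sub_distrib]
      exact Finset.sum_congr rfl fun x _ => by ring
    rw [h4]
    have h5 : (G.boundary A : ℝ) ≤ φ * G.volume A := by
      rwa [SimpleGraph.conductance, div_le_iff₀ hμ] at hAφ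
    have h6 : (timeLimit φ : ℝ) * (G.boundary A / 2) ≤ φ⁻¹ / 100 * (φ * G.volume A / 2) := by
      have := (timeLimit_bounds hφ hT).1
      gcongr
    have h7 : φ⁻¹ / 100 * (φ * G.volume A / 2) = G.volume A / 200 := by
      field_simp
      norm_num
    linarith

theorem le_overlap (hG : 0 < G.volume Finset.univ) {φ : ℝ} (hφ : 0 < φ) {A : Finset V}
    (hA0 : 0 < G.volume A) (hA : (G.volume A : ℝ) ≤ 2 / 3 * G.volume Finset.univ)
    (hAφ : G.conductance A ≤ φ) : 1 / (20 * (G.volume Finset.univ : ℝ)) ≤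
      ∑ S : Finset V, (output G hG φ S).toReal *
        ((G.volume (S ∩ A) : ℝ) / (G.volume A : ℝ)) := by
  have hμ : (0 : ℝ) < G.volume A := by exact_mod_cast hA0
  have hM : (0 : ℝ) < G.volume Finset.univ := by exact_mod_cast hG
  have h1 : ENNReal.ofReal ((G.volume Finset.univ : ℝ)⁻¹ * (G.volume A / 20)) ≤
      (output G hG φ).expect (fun S => (G.volume (S ∩ A) : ℝ≥0∞)) := by
    rw [expect_output, ENNReal.ofReal_mul (by positivity), ENNReal.ofReal_inv_of_pos hM,
      ENNReal.ofReal_natCast, ← Finset.mul_sum]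
    gcongr
    refine (le_sum_degree_mul_generateSample (G.two_le_volume_univ hG) hφ hA0 hA hAφ).trans ?_
    exact Finset.sum_le_sum_of_subset (Finset.subset_univ A)
  rw [PMF.expect_fintype] at h1
  have hfin : ∀ S ∈ Finset.univ,
      output G hG φ S * (G.volume (S ∩ A) : ℝ≥0∞) ≠ ∞ := fun S _ =>
    ENNReal.mul_ne_top ((output G hG φ).apply_ne_top S) (ENNReal.natCast_ne_top _)
  rw [ENNReal.ofReal_le_iff_le_toReal (ENNReal.sum_ne_top.2 hfin), ENNReal.toReal_sum hfin] at h1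
  simp only [ENNReal.toReal_mul, ENNReal.toReal_natCast] at h1
  simp only [← mul_div_assoc]
  rw [← Finset.sum_div, le_div_iff₀ hμ]
  refine le_trans (le_of_eq ?_) h1
  field_simp

end EvoNibble

theorem theorem5 :
    ∃ C : ℝ, 0 < C ∧
      ∀ (V : Type*) [Fintype V] [LinearOrder V] (G : SimpleGraph V) [DecidableRel G.Adj]
        (hG : 0 < G.volume Finset.univ) (φ : ℝ), 0 < φ → φ < 1 →
        EvoNibble.expectedWork G hG φ ≤
            ENNReal.ofReal
              (C * (φ ^ (-(1 / 2) : ℝ) * Real.log (G.volume Finset.univ) ^ (5 / 2 : ℝ))) ∧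
          (∀ S ∈ (EvoNibble.output G hG φ).support,
            S = ∅ ∨
              (G.conductance S ≤ C * Real.sqrt (φ * Real.log (G.volume Finset.univ)) ∧
                (G.volume S : ℝ) ≤ 3 / 4 * G.volume Finset.univ)) ∧
          ∀ A : Finset V, 0 < G.volume A →
            (G.volume A : ℝ) ≤ 2 / 3 * G.volume Finset.univ → G.conductance A ≤ φ →
              1 / (20 * (G.volume Finset.univ : ℝ)) ≤
                ∑ S : Finset V, (EvoNibble.output G hG φ S).toReal *
                  ((G.volume (S ∩ A) : ℝ) / (G.volume A : ℝ)) := by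
  refine ⟨10 ^ 5, by norm_num, fun V _ _ G _ hG φ hφ hφ1 => ⟨?_, ?_, ?_⟩⟩
  · exact EvoNibble.expectedWork_le G hG hφ hφ1
  · intro S hS
    rcases EvoNibble.mem_support_output G hG hS with h | ⟨h1, h2⟩
    · exact Or.inl h
    · exact Or.inr
        ⟨EvoNibble.conductance_le_of_le_theta G hφ h1 (G.two_le_volume_univ hG), h2⟩
  · exact fun A hA0 hA hAφ => EvoNibble.le_overlap hG hφ hA0 hA hAφ
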